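/- Let $\mathbb K$ be a field of characteristic $0$, $n\ge 1$, $\langle x,y\rangle=\sum_i x_iy_i$ for $x,y\in\mathbb Z^n$, $\mathcal A=\bigoplus_{\gamma\in\mathbb Z^n}\mathcal A^\gamma$ an associative unital $\mathbb Z^n$-graded commutative $\mathbb K$-algebra ($fg=(-1)^{\langle f,g\rangle}gf$; a homogeneous vector or map and its degree are denoted by the same letter), and fix $\alpha\in\mathbb Z^n$. **Operators.** For $a\ge -1$ and $A\in\mathbb Z^n$, let $\mathrm{Diff}_1^{(A+\alpha a,a)}(\mathcal A)$ be $\mathcal A^A$ if $a=-1$, and, if $a\ge 0$, the space of $(a+1)$-linear maps $A:\mathcal A^{a+1}\to\mathcal A$ of weight $A$ that are $\alpha$-graded antisymmetric (exchanging two neighbouring arguments $u,v$ produces the sign $-(-1)^{\langle u+\alpha,v+\alpha\rangle}$) and first order: for $a=0$, $A(fg)=A(f)g+(-1)^{\langle A,f\rangle}fA(g)-A(1)fg$; for $a\ge1$, inductively, each $A(v)=A(v,-,\dots,-)$, $v$ homogeneous, is a first order operator with $a$ arguments, of weight $A+v$. **Grabowski–Marmo bracket.** It is defined inductively, for multilinear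 maps $A$, $B$ of weights $A$, $B$ with $a+1$, $b+1$ arguments and homogeneous $v,w\in\mathcal A$, by $[v,w]^{GM}=0$, $[A,v]^{GM}=(-1)^{1-a}A(v)$, $[v,A]^{GM}=-(-1)^{\langle v-\alpha,A+\alpha a\rangle+a}[A,v]^{GM}$ ($a\ge0$) and $$[A,B]^{GM}(v)=(-1)^a[A,B(v)]^{GM}+(-1)^{\langle B+\alpha b,\,v-\alpha\rangle}[A(v),B]^{GM}\qquad(a,b\ge 0).$$ **Square product.** It is defined inductively by $v\square w=0$, $A\square v=(-1)^{1-a}A(v)$, $v\square A=0$ ($a\ge 0$) and $$(A\square B)(v)=(-1)^aA\square B(v)+(-1)^{\langle B+\alpha b,\,v-\alpha\rangle}A(v)\square B\qquad(a,b\ge0).$$ **Stem and Nijenhuis–Richardson brackets.** Let $V$ be a $\mathbb Z^n$-graded vector space and $e_1=(1,0,\dots,0)$. An unshuffle is an increasing tuple of indices; for disjoint unshuffles $I,J$, $(-1)^{(I;J)}$ and $\varepsilon_V(I;J)$ denote the signature and the Koszul sign of the reordering $(I;J)\to I\cup J$. Let $\downarrow V$ be $V$ with the gradation $(\downarrow V)^\gamma=V^{\gamma+e_1}$;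 for an $(a+1)$-linear map $A$ on $V$ of weight $A$, $a\ge0$, let $\phi(A)$ be the coderivation of the reduced tensor algebra $T(\downarrow V)$, of weight $Q=A+ae_1$, whose only nonzero corestriction is $Q_{a+1}=(-1)^{a(a+1)/2}\downarrow\circ A\circ\uparrow^{\otimes(a+1)}$, i.e. on $W=\downarrow V$ $$\phi(A)(w_1\otimes\dots\otimes w_p)=\sum_{I\cup J\cup K=(1,\dots,p),\ I,J<K,\ |J|=a}\varepsilon_{W}(I;J)(-1)^{\langle Q,W_I\rangle}\,W_I\otimes Q_{a+1}(W_J\otimes w_{k_1})\otimes W_{K\setminus k_1},$$ where $I,J<K$ means that all elements of $I$ and $J$ precede the first element $k_1$ of the nonempty $K$, and where $\uparrow^{\otimes p}$ and $\downarrow^{\otimes p}$ carry the sign $(-1)^{\sum_s\langle(p-s)e_1,x_s\rangle}$ on homogeneous $x_1\otimes\dots\otimes x_p$. The stem bracket is $$[A,B]^{\otimes}=(-1)^{1+\langle ae_1,\,be_1+B\rangle}\phi^{-1}\big(\phi(A)\phi(B)-(-1)^{\langle A+ae_1,B+be_1\rangle}\phi(B)\phi(A)\big),$$ where $\phi^{-1}$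 sends $Q$ to $\uparrow\circ Q_{a+b+1}\circ\downarrow^{\otimes(a+b+1)}$, $Q_{a+b+1}$ being the corestriction of $Q$ to $(\downarrow V)^{\otimes(a+b+1)}$. On graded antisymmetric maps, including elements of $V$ ($a=-1$), the Nijenhuis–Richardson bracket is $[A,B]^{NR}=i_AB-(-1)^{\langle A,B\rangle+ab}i_BA$ with $$(i_BA)(v_1,\dots,v_{a+b+1})=(-1)^{\langle A,B\rangle}\sum_{I\cup J=(1,\dots,a+b+1),\ |I|=b+1,\ |J|=a}(-1)^{(I;J)}\varepsilon_V(I;J)\,A(B(V_I),V_J)$$ (empty sum for $a=-1$). **Statement.** Let $a,b\ge-1$, not both $-1$, $A\in\mathrm{Diff}_1^{(A+\alpha a,a)}(\mathcal A)$ and $B\in\mathrm{Diff}_1^{(B+\alpha b,b)}(\mathcal A)$. Then: 1. $[A,B]^{GM}\in\mathrm{Diff}_1^{(A+B+\alpha(a+b),\,a+b)}(\mathcal A)$, and $$[A,B]^{GM}=A\square B-(-1)^{\langle A+\alpha a,B+\alpha b\rangle+ab}\,B\square A.$$ 2. For homogeneous $v_1,\dots,v_{a+b+1}\in\mathcal A$,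 $$(A\square B)(v_1,\dots,v_{a+b+1})=(-1)^{1+ab}\sum_{I\cup J=(1,\dots,a+b+1),\ |I|=b+1,\ |J|=a}(-1)^{(I;J)}\varepsilon(I;J)\,A(B(V_I),V_J),$$ where the Koszul sign $\varepsilon$ is computed with the degrees $v_i-\alpha$. 3. Let $\downarrow_\alpha\mathcal A$ be $\mathcal A$ with the gradation $(\downarrow_\alpha\mathcal A)^\gamma=\mathcal A^{\gamma+\alpha}$ and, for an $(a+1)$-linear map $A$ of weight $A$ on $\mathcal A$, let $\tilde A$ be the same map regarded as a map of weight $A+\alpha a$ on $\downarrow_\alpha\mathcal A$ (this exchanges $\alpha$-graded antisymmetry on $\mathcal A$ and graded antisymmetry on $\downarrow_\alpha\mathcal A$). Then $[A,B]^{GM}$ corresponds under $\sim$ to $[\tilde A,\tilde B]^{NR}$, and, if $a,b\ge0$, to the stem bracket $[\tilde A,\tilde B]^{\otimes}$, on the graded vector space $V=\downarrow_\alpha\mathcal A$. That is, the Grabowski–Marmo bracket is the restriction to $\mathrm{Diff}_1(\mathcal A)$ of the pullback of the stem (Nijenhuis–Richardson) bracket. -/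

import Mathlib

open scoped DirectSum TensorProduct

noncomputable section

namespace GradedBracket

/-- The grading group `ℤⁿ`. -/
abbrev Deg (n : ℕ) := Fin n → ℤ

/-- The pairing `⟨x, y⟩ = ∑ᵢ xᵢ yᵢ` of two degrees. -/
def pair {n : ℕ} (x y : Deg n) : ℤ := ∑ i, x i * y i

/-- The sign `(-1)^k`, as a scalar. -/
def sgn (K : Type*) [Field K] (k : ℤ) : K := (-1 : K) ^ k

/-- The degree `e₁ = (1, 0, …, 0)`. -/
def e₁ {n : ℕ} [NeZero n] : Deg n := Pi.single 0 1

/-- `p`-linear maps `V × ⋯ × V → V`; for `p = 0` these are the elements of `V`. -/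
abbrev Cochain (K V : Type*) [Field K] [AddCommGroup V] [Module K V] (p : ℕ) :=
  MultilinearMap K (fun _ : Fin p => V) V

section Graded

variable {K V M : Type*} [Field K] [AddCommGroup V] [Module K V] [AddCommGroup M] [Module K M]
variable {n : ℕ}

/-! ### Shifted gradings and extension from homogeneous vectors -/

/-- The desuspended grading `(↓V)^γ = V^{γ + δ}` on the same underlying space. -/
def desuspend (𝒱 : Deg n → Submodule K V) (δ : Deg n) : Deg n → Submodule K V :=
  fun γ => 𝒱 (γ + δ)

theorem desuspend_isInternal (𝒱 : Deg n → Submodule K V) [DirectSum.Decomposition 𝒱]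
    (δ : Deg n) : DirectSum.IsInternal (desuspend 𝒱 δ) := by
  have h := DirectSum.Decomposition.isInternal 𝒱
  refine DirectSum.isInternal_submodule_of_iSupIndep_of_iSup_eq_top ?_ ?_
  · exact h.submodule_iSupIndep.comp (add_left_injective δ)
  · rw [← h.submodule_iSup_eq_top]
    exact (Equiv.addRight δ).surjective.iSup_comp 𝒱

instance desuspendDecomposition (𝒱 : Deg n → Submodule K V) [DirectSum.Decomposition 𝒱]
    (δ : Deg n) : DirectSum.Decomposition (desuspend 𝒱 δ) :=
  (desuspend_isInternal 𝒱 δ).chooseDecomposition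

/-- The linear map that coincides on `V^γ` with `F γ`. -/
def homExtLinear (𝒱 : Deg n → Submodule K V) [DirectSum.Decomposition 𝒱]
    (F : Deg n → V →ₗ[K] M) : V →ₗ[K] M :=
  (DirectSum.toModule K (Deg n) M (fun γ => (F γ).comp (𝒱 γ).subtype)).comp
    (DirectSum.decomposeLinearEquiv 𝒱).toLinearMap

/-- The multilinear map that coincides on `V^{d₁} × ⋯ × V^{dₚ}` with `G d`. -/
def homExt (𝒱 : Deg n → Submodule K V) [DirectSum.Decomposition 𝒱] {p : ℕ}
    (G : (Fin p → Deg n) → MultilinearMap K (fun _ : Fin p => V) M) :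
    MultilinearMap K (fun _ : Fin p => V) M :=
  MultilinearMap.compLinearMap
    (MultilinearMap.fromDirectSumEquiv (R := K) (M := fun (_ : Fin p) (γ : Deg n) => 𝒱 γ)
      (fun d => (G d).compLinearMap (fun i => (𝒱 (d i)).subtype)))
    (fun _ => (DirectSum.decomposeLinearEquiv 𝒱).toLinearMap)

theorem homExtLinear_apply (𝒱 : Deg n → Submodule K V) [DirectSum.Decomposition 𝒱]
    (F : Deg n → V →ₗ[K] M) {γ : Deg n} {v : V} (hv : v ∈ 𝒱 γ) :
    homExtLinear 𝒱 F v = F γ v := by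
  have h := DirectSum.decomposeLinearEquiv_apply_coe 𝒱 γ ⟨v, hv⟩
  simp only at h
  simp [homExtLinear, h]

theorem homExtLinear_add (𝒱 : Deg n → Submodule K V) [DirectSum.Decomposition 𝒱]
    (F G : Deg n → V →ₗ[K] M) :
    homExtLinear 𝒱 (fun γ => F γ + G γ) = homExtLinear 𝒱 F + homExtLinear 𝒱 G := by
  refine DirectSum.decompose_lhom_ext 𝒱 (fun γ => LinearMap.ext fun v => ?_)
  simp [homExtLinear_apply 𝒱 _ v.2]

theorem homExtLinear_smul (𝒱 : Deg n → Submodule K V) [DirectSum.Decomposition 𝒱]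
    (c : K) (F : Deg n → V →ₗ[K] M) :
    homExtLinear 𝒱 (fun γ => c • F γ) = c • homExtLinear 𝒱 F := by
  refine DirectSum.decompose_lhom_ext 𝒱 (fun γ => LinearMap.ext fun v => ?_)
  simp [homExtLinear_apply 𝒱 _ v.2]

/-- `f ↦ A` with `A(v, v₁, …, vₘ) = f(v)(v₁, …, vₘ)`. -/
def uncurry (m : ℕ) : (V →ₗ[K] Cochain K V m) →ₗ[K] Cochain K V (m + 1) :=
  (multilinearCurryLeftEquiv K (fun _ : Fin (m + 1) => V) V).symm.toLinearMap

theorem homExt_apply (𝒱 : Deg n → Submodule K V) [DirectSum.Decomposition 𝒱] {p : ℕ}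
    (G : (Fin p → Deg n) → MultilinearMap K (fun _ : Fin p => V) M)
    {d : Fin p → Deg n} {v : Fin p → V} (hv : ∀ i, v i ∈ 𝒱 (d i)) :
    homExt 𝒱 G v = G d v := by
  have h : ∀ i, (DirectSum.decomposeLinearEquiv 𝒱) (v i)
      = DirectSum.lof K _ (fun γ => 𝒱 γ) (d i) ⟨v i, hv i⟩ := fun i =>
    DirectSum.decomposeLinearEquiv_apply_coe 𝒱 (d i) ⟨v i, hv i⟩
  simp only [homExt, MultilinearMap.compLinearMap_apply, LinearEquiv.coe_coe, h]
  rw [MultilinearMap.fromDirectSumEquiv_lof (R := K) (κ := fun _ : Fin p => Deg n)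
    (M := fun (_ : Fin p) (γ : Deg n) => 𝒱 γ)]
  rfl

/-! ### Weights and antisymmetry -/

/-- `A` has weight `w`. -/
def HasWeight (𝒱 : Deg n → Submodule K V) {p : ℕ} (w : Deg n) (A : Cochain K V p) : Prop :=
  ∀ (d : Fin p → Deg n) (v : Fin p → V), (∀ i, v i ∈ 𝒱 (d i)) → A v ∈ 𝒱 (w + ∑ i, d i)

/-- `α`-graded antisymmetry, with respect to exchanges of two neighbouring arguments. -/
def IsAlphaSkew (𝒱 : Deg n → Submodule K V) (α : Deg n) {p : ℕ} (A : Cochain K V p) : Prop :=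
  ∀ (d : Fin p → Deg n) (v : Fin p → V), (∀ i, v i ∈ 𝒱 (d i)) →
    ∀ i j : Fin p, (i : ℕ) + 1 = j →
      A (v ∘ Equiv.swap i j) = -(sgn K (pair (d i + α) (d j + α)) • A v)

/-- The first component `A + α a` of the bidegree `(A + α a, a)` of a `p`-linear map of weight
`A = w`, where `a = p - 1`. -/
def biDeg (α w : Deg n) (p : ℕ) : Deg n := w + ((p : ℤ) - 1) • α

/-! ### The square product and the Grabowski–Marmo bracket

Both are families of bilinear maps, indexed by the numbers of arguments `p = a + 1`, `q = b + 1`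
and the weights `wA`, `wB`; the result has `m = a + b + 1` arguments. -/

/-- `(A, v) ↦ (-1)^{1-a} A(v)` for `A` with `a + 1` arguments and `v ∈ V`. -/
def insertVec (K V : Type*) [Field K] [AddCommGroup V] [Module K V] (a : ℕ) :
    Cochain K V (a + 1) →ₗ[K] Cochain K V 0 →ₗ[K] Cochain K V a :=
  LinearMap.mk₂ K (fun A v => sgn K (1 - (a : ℤ)) • A.curryLeft (v Fin.elim0))
    (fun A A' v => by ext; simp [smul_add])
    (fun c A v => by ext; simp [smul_smul, mul_comm])
    (fun A v v' => by simp [smul_add])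
    (fun c A v => by simp only [smul_apply, map_smul]; rw [smul_comm])

/-- For two families of bilinear maps `F γ`, `G γ`, the bilinear map `(A, B) ↦ C` with
`C(v) = F γ A (B(v)) + G γ (A(v)) B` for all `v ∈ V^γ`. -/
def recStep (𝒱 : Deg n → Submodule K V) [DirectSum.Decomposition 𝒱] {m p q : ℕ}
    (F : Deg n → Cochain K V (p + 1) →ₗ[K] Cochain K V q →ₗ[K] Cochain K V m)
    (G : Deg n → Cochain K V p →ₗ[K] Cochain K V (q + 1) →ₗ[K] Cochain K V m) :
    Cochain K V (p + 1) →ₗ[K] Cochain K V (q + 1) →ₗ[K] Cochain K V (m + 1) :=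
  (LinearMap.mk₂ K
    (fun A B => homExtLinear 𝒱 fun γ =>
      (F γ A).comp B.curryLeft + ((G γ).flip B).comp A.curryLeft)
    (fun A A' B => by
      rw [← homExtLinear_add]
      refine congrArg (homExtLinear 𝒱) (funext fun γ => LinearMap.ext fun v => ?_)
      change F γ (A + A') (B.curryLeft v) + G γ (A.curryLeft v + A'.curryLeft v) B =
        (F γ A (B.curryLeft v) + G γ (A.curryLeft v) B) +
          (F γ A' (B.curryLeft v) + G γ (A'.curryLeft v) B)
      rw [map_add, map_add, LinearMap.add_apply, LinearMap.add_apply, add_add_add_comm])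
    (fun c A B => by
      rw [← homExtLinear_smul]
      refine congrArg (homExtLinear 𝒱) (funext fun γ => LinearMap.ext fun v => ?_)
      change F γ (c • A) (B.curryLeft v) + G γ (c • A.curryLeft v) B =
        c • (F γ A (B.curryLeft v) + G γ (A.curryLeft v) B)
      rw [map_smul, map_smul, LinearMap.smul_apply, LinearMap.smul_apply, smul_add])
    (fun A B B' => by
      rw [← homExtLinear_add]
      refine congrArg (homExtLinear 𝒱) (funext fun γ => LinearMap.ext fun v => ?_)
      change F γ A (B.curryLeft v + B'.curryLeft v) + G γ (A.curryLeft v) (B + B') =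
        (F γ A (B.curryLeft v) + G γ (A.curryLeft v) B) +
          (F γ A (B'.curryLeft v) + G γ (A.curryLeft v) B')
      rw [map_add, map_add, add_add_add_comm])
    (fun c A B => by
      rw [← homExtLinear_smul]
      refine congrArg (homExtLinear 𝒱) (funext fun γ => LinearMap.ext fun v => ?_)
      change F γ A (c • B.curryLeft v) + G γ (A.curryLeft v) (c • B) =
        c • (F γ A (B.curryLeft v) + G γ (A.curryLeft v) B)
      rw [map_smul, map_smul, smul_add])).compr₂ (uncurry m)

/-- The bracket `[-,-]^GM`, defined inductively by
* `[v, w] = 0`, `[A, v] = (-1)^{1-a} A(v)`,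
* `[v, A] = -(-1)^{⟨v - α, A + α a⟩ + a} [A, v]`,
* `[A, B](v) = (-1)^a [A, B(v)] + (-1)^{⟨B + α b, v - α⟩} [A(v), B]`, `a, b ≥ 0`. -/
def gmBracket (𝒱 : Deg n → Submodule K V) [DirectSum.Decomposition 𝒱] (α : Deg n) :
    (m p q : ℕ) → p + q = m + 1 → (wA wB : Deg n) →
      Cochain K V p →ₗ[K] Cochain K V q →ₗ[K] Cochain K V m
  | _, 0, 0, _, _, _ => 0
  | m, a + 1, 0, h, _, _ => by
      obtain rfl : a = m := by omega
      exact insertVec K V a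
  | m, 0, a + 1, h, wv, wA => by
      obtain rfl : a = m := by omega
      exact (-sgn K (pair (wv - α) (biDeg α wA (a + 1)) + a)) • (insertVec K V a).flip
  | 0, _ + 1, _ + 1, _, _, _ => 0
  | m + 1, a + 1, b + 1, h, wA, wB =>
      recStep 𝒱
        (fun γ => sgn K (a : ℤ) • gmBracket 𝒱 α m (a + 1) b (by omega) wA (wB + γ))
        (fun γ => sgn K (pair (biDeg α wB (b + 1)) (γ - α)) •
          gmBracket 𝒱 α m a (b + 1) (by omega) (wA + γ) wB)

/-- The product `A □ B`, defined inductively by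
* `v □ w = 0`, `A □ v = (-1)^{1-a} A(v)`, `v □ A = 0`,
* `(A □ B)(v) = (-1)^a A □ B(v) + (-1)^{⟨B + α b, v - α⟩} A(v) □ B`, `a, b ≥ 0`. -/
def square (𝒱 : Deg n → Submodule K V) [DirectSum.Decomposition 𝒱] (α : Deg n) :
    (m p q : ℕ) → p + q = m + 1 → (wA wB : Deg n) →
      Cochain K V p →ₗ[K] Cochain K V q →ₗ[K] Cochain K V m
  | _, 0, 0, _, _, _ => 0
  | m, a + 1, 0, h, _, _ => by
      obtain rfl : a = m := by omega
      exact insertVec K V a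
  | _, 0, _ + 1, _, _, _ => 0
  | 0, _ + 1, _ + 1, _, _, _ => 0
  | m + 1, a + 1, b + 1, h, wA, wB =>
      recStep 𝒱
        (fun γ => sgn K (a : ℤ) • square 𝒱 α m (a + 1) b (by omega) wA (wB + γ))
        (fun γ => sgn K (pair (biDeg α wB (b + 1)) (γ - α)) •
          square 𝒱 α m a (b + 1) (by omega) (wA + γ) wB)

/-! ### Unshuffles -/

/-- The signature `(-1)^{(I;J)}` of the permutation `(I;J) → I ∪ J` of two unshuffles `I`, `J`. -/
def shuffleSign (K : Type*) [Field K] {m i j : ℕ} (I : Fin i → Fin m) (J : Fin j → Fin m) : K :=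
  ∏ x, ∏ y, if J y < I x then (-1 : K) else 1

/-- The Koszul sign `ε(I;J)` of `(I;J) → I ∪ J`, for vectors of degrees `d₁, …, dₘ`. -/
def koszulSign (K : Type*) [Field K] {m i j : ℕ} (d : Fin m → Deg n)
    (I : Fin i → Fin m) (J : Fin j → Fin m) : K :=
  ∏ x, ∏ y, if J y < I x then sgn K (pair (d (I x)) (d (J y))) else 1

open Classical in
/-- The pairs of unshuffles `(I;J)` with `|I| = i`, `|J| = j` and `I ∪ J = (1, …, m)`; such a pair
is encoded by the bijection `σ` with `I = σ ∘ inl` and `J = σ ∘ inr`. -/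
def unshuffles (i j m : ℕ) : Finset (Fin i ⊕ Fin j ≃ Fin m) :=
  Finset.univ.filter fun σ =>
    StrictMono (fun x => σ (Sum.inl x)) ∧ StrictMono (fun y => σ (Sum.inr y))

/-- `(x₁, …, x_q, y₁, …, y_a) ↦ A(B(x₁, …, x_q), y₁, …, y_a)`. -/
def insertFirst {a q : ℕ} (A : Cochain K V (a + 1)) (B : Cochain K V q) :
    MultilinearMap K (fun _ : Fin q ⊕ Fin a => V) V :=
  MultilinearMap.uncurrySum (N := fun _ : Fin q ⊕ Fin a => V)
    (A.curryLeft.compMultilinearMap B)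

/-- The sum `∑ (-1)^{(I;J)} ε(I;J) A(B(v_I), v_J)` over the unshuffles with `I ∪ J = (1, …, m)`,
`|I| = b + 1`, `|J| = a`, where the Koszul sign is computed with the degrees `d`, and where `A`
has `p = a + 1` and `B` has `q = b + 1` arguments. For `a = -1` the sum is empty. -/
def unshuffleSum {m : ℕ} (d : Fin m → Deg n) :
    {p q : ℕ} → Cochain K V p → Cochain K V q → Cochain K V m
  | 0, _, _, _ => 0
  | a + 1, q, A, B => ∑ σ ∈ unshuffles q a m,
      (shuffleSign K (fun x => σ (Sum.inl x)) (fun y => σ (Sum.inr y)) *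
        koszulSign K d (fun x => σ (Sum.inl x)) (fun y => σ (Sum.inr y))) •
      (insertFirst A B).domDomCongr σ

/-! ### The graded Nijenhuis–Richardson bracket -/

/-- The insertion `i_B A` of `B` (of weight `wB`) into `A` (of weight `wA`), on antisymmetric
multilinear maps: `(i_B A)(v) = (-1)^{⟨A, B⟩} ∑ (-1)^{(I;J)} ε_V(I;J) A(B(v_I), v_J)`. -/
def nrInsert (𝒱 : Deg n → Submodule K V) [DirectSum.Decomposition 𝒱] (m : ℕ) {p q : ℕ}
    (wA wB : Deg n) (A : Cochain K V p) (B : Cochain K V q) : Cochain K V m :=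
  sgn K (pair wA wB) • homExt 𝒱 (fun d => unshuffleSum d A B)

/-- `[A, B]^NR = i_A B - (-1)^{⟨A, B⟩ + a b} i_B A`, of `m = a + b + 1` arguments. -/
def nrBracket (𝒱 : Deg n → Submodule K V) [DirectSum.Decomposition 𝒱] (m : ℕ) {p q : ℕ}
    (wA wB : Deg n) (A : Cochain K V p) (B : Cochain K V q) : Cochain K V m :=
  nrInsert 𝒱 m wB wA B A -
    sgn K (pair wA wB + ((p : ℤ) - 1) * ((q : ℤ) - 1)) • nrInsert 𝒱 m wA wB A B

/-! ### The stem bracket -/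

open Classical in
/-- The triples of unshuffles `(I; J ∪ k₁; K \ k₁)` with `I ∪ J ∪ K = (1, …, p)`, `I, J < K`,
`|I| = i`, `|J| = b`, `|K| = r + 1`, where `k₁` is the first element of `K`. Such a triple is
encoded by a bijection, and `J < k₁` is part of the monotonicity on the second block. -/
def coderUnshuffles (i b r p : ℕ) : Finset (Fin i ⊕ (Fin (b + 1) ⊕ Fin r) ≃ Fin p) :=
  Finset.univ.filter fun σ =>
    StrictMono (fun x => σ (Sum.inl x)) ∧
    StrictMono (fun y => σ (Sum.inr (Sum.inl y))) ∧
    StrictMono (fun z => σ (Sum.inr (Sum.inr z))) ∧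
    (∀ x, σ (Sum.inl x) < σ (Sum.inr (Sum.inl (Fin.last b)))) ∧
    (∀ z, σ (Sum.inr (Sum.inl (Fin.last b))) < σ (Sum.inr (Sum.inr z)))

/-- `(x; y; z) ↦ x₁ ⊗ ⋯ ⊗ xᵢ ⊗ f(y₁, …, y_{b+1}) ⊗ z₁ ⊗ ⋯ ⊗ z_r`. -/
def tensorInsert (i r : ℕ) {b : ℕ} (f : Cochain K V (b + 1)) :
    MultilinearMap K (fun _ : Fin i ⊕ (Fin (b + 1) ⊕ Fin r) => V) (TensorAlgebra K V) :=
  (LinearMap.mul' K (TensorAlgebra K V)).compMultilinearMap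
    ((TensorAlgebra.tprod K V i).domCoprod
      ((LinearMap.mul' K (TensorAlgebra K V)).compMultilinearMap
        (((TensorAlgebra.ι K).compMultilinearMap f).domCoprod (TensorAlgebra.tprod K V r))))

/-- The coderivation `Q` of weight `w` of the tensor coalgebra of the graded space `(V, 𝒱)` whose
only nonvanishing corestriction map is `f : V^{⊗(b+1)} → V`: on homogeneous vectors,
`Q(v₁ ⊗ ⋯ ⊗ vₚ) = ∑ ε_V(I;J) (-1)^{⟨Q, V_I⟩} V_I ⊗ f(V_J ⊗ v_{k₁}) ⊗ V_{K \ k₁}`,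
summed over `I ∪ J ∪ K = (1, …, p)` with `I, J < K` and `|J| = b`. It vanishes on `V^{⊗0}`, i.e. it
lives on the reduced tensor algebra. -/
def coderivation (𝒱 : Deg n → Submodule K V) [DirectSum.Decomposition 𝒱] (w : Deg n) {b : ℕ}
    (f : Cochain K V (b + 1)) : TensorAlgebra K V →ₗ[K] TensorAlgebra K V :=
  (DirectSum.toModule K ℕ (TensorAlgebra K V) (fun p => PiTensorProduct.lift
    (homExt 𝒱 (fun d : Fin p → Deg n =>
      ∑ i ∈ Finset.range (p + 1), ∑ r ∈ Finset.range (p + 1), ∑ σ ∈ coderUnshuffles i b r p,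
        (koszulSign K d (fun x => σ (Sum.inl x)) (fun y => σ (Sum.inr (Sum.inl y))) *
          sgn K (∑ x : Fin i, pair w (d (σ (Sum.inl x))))) •
        (tensorInsert i r f).domDomCongr σ)))).comp
  (TensorAlgebra.equivDirectSum (R := K) (M := V)).toLinearMap

/-- The corestriction `V^{⊗p} → T(V) → T(V) → V` of a linear map of `T(V)`. -/
def corestriction (p : ℕ) (Q : TensorAlgebra K V →ₗ[K] TensorAlgebra K V) : Cochain K V p :=
  (TensorAlgebra.ιInv.comp Q).compMultilinearMap (TensorAlgebra.tprod K V p)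

variable [NeZero n]

/-- `(-1)^{p(p-1)/2} ↓ ∘ A ∘ ↑^{⊗p}`, a `p`-linear map of `↓V`, `(↓V)^γ = V^{γ + e₁}`. Here
`↑^{⊗p}` sends `w₁ ⊗ ⋯ ⊗ wₚ`, of degrees `dₛ` in `↓V`, to
`(-1)^{∑ₛ ⟨(p - s) e₁, dₛ⟩} ↑w₁ ⊗ ⋯ ⊗ ↑wₚ`. -/
def toDesuspension (𝒱 : Deg n → Submodule K V) [DirectSum.Decomposition 𝒱] {p : ℕ}
    (A : Cochain K V p) : Cochain K V p :=
  homExt (desuspend 𝒱 e₁) (fun d =>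
    (sgn K ((p * (p - 1) / 2 : ℕ) : ℤ) *
      sgn K (∑ s : Fin p, ((p : ℤ) - ((s : ℤ) + 1)) * pair e₁ (d s))) • A)

/-- `↑ ∘ Q ∘ ↓^{⊗p}`, a `p`-linear map of `V`, where `↓^{⊗p}` sends `v₁ ⊗ ⋯ ⊗ vₚ`, of degrees `dₛ`
in `V`, to `(-1)^{∑ₛ ⟨(p - s) e₁, dₛ⟩} ↓v₁ ⊗ ⋯ ⊗ ↓vₚ`. -/
def ofDesuspension (𝒱 : Deg n → Submodule K V) [DirectSum.Decomposition 𝒱] {p : ℕ}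
    (Q : Cochain K V p) : Cochain K V p :=
  homExt 𝒱 (fun d =>
    sgn K (∑ s : Fin p, ((p : ℤ) - ((s : ℤ) + 1)) * pair e₁ (d s)) • Q)

/-- The coderivation `φ(A) = Q^A` of `T(↓V)`, of weight `A + a e₁`, attached to a map `A` of weight
`wA` with `a + 1` arguments. -/
def stemPhi (𝒱 : Deg n → Submodule K V) [DirectSum.Decomposition 𝒱] {a : ℕ} (wA : Deg n)
    (A : Cochain K V (a + 1)) : TensorAlgebra K V →ₗ[K] TensorAlgebra K V :=
  coderivation (desuspend 𝒱 e₁) (wA + (a : ℤ) • e₁) (toDesuspension 𝒱 A)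

/-- The stem bracket `[A, B]^⊗ = (-1)^{1 + ⟨a e₁, b e₁ + B⟩} φ⁻¹([φ(A), φ(B)])`, where
`[φ(A), φ(B)]` is the graded commutator of coderivations. -/
def stemBracket (𝒱 : Deg n → Submodule K V) [DirectSum.Decomposition 𝒱] {a b : ℕ} (wA wB : Deg n)
    (A : Cochain K V (a + 1)) (B : Cochain K V (b + 1)) : Cochain K V (a + b + 1) :=
  sgn K (1 + pair ((a : ℤ) • e₁ : Deg n) ((b : ℤ) • e₁ + wB)) •
    ofDesuspension 𝒱 (corestriction (a + b + 1)
      ((stemPhi 𝒱 wA A).comp (stemPhi 𝒱 wB B) -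
        sgn K (pair (wA + (a : ℤ) • e₁) (wB + (b : ℤ) • e₁)) •
          (stemPhi 𝒱 wB B).comp (stemPhi 𝒱 wA A)))

end Graded

/-! ### First order polydifferential operators and the pulled back brackets -/

section Algebra

variable {K R : Type*} [Field K] [Ring R] [Algebra K R] {n : ℕ}

/-- First order polydifferential operators, inductively: elements of `𝒜` for `p = 0`; maps `D` with
`D(f g) = D(f) g + (-1)^{⟨D, f⟩} f D(g) - D(1) f g` for `p = 1`; and for `p ≥ 2` the maps whose
values `A(v)`, for `v` homogeneous, are such operators with `p - 1` arguments. -/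
def IsFirstOrder (𝒜 : Deg n → Submodule K R) :
    (p : ℕ) → (w : Deg n) → Cochain K R p → Prop
  | 0, _, _ => True
  | 1, w, D => ∀ (γ : Deg n) (f g : R), f ∈ 𝒜 γ →
      D (fun _ => f * g) =
        D (fun _ => f) * g + sgn K (pair w γ) • (f * D (fun _ => g)) - D (fun _ => 1) * f * g
  | p + 2, w, A => ∀ (γ : Deg n) (v : R), v ∈ 𝒜 γ → IsFirstOrder 𝒜 (p + 1) (w + γ) (A.curryLeft v)

/-- `A ∈ Diff₁^{(w + α a, a)}(𝒜)`: `A` is an `α`-antisymmetric graded first order polydifferential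
operator of weight `w` with `p = a + 1` arguments. -/
structure IsDiff₁ (𝒜 : Deg n → Submodule K R) (α : Deg n) (p : ℕ) (w : Deg n)
    (A : Cochain K R p) : Prop where
  weight : HasWeight 𝒜 w A
  skew : IsAlphaSkew 𝒜 α A
  firstOrder : IsFirstOrder 𝒜 p w A

/-- `ℤⁿ`-graded commutativity of an algebra. -/
def IsGradedComm (𝒜 : Deg n → Submodule K R) : Prop :=
  ∀ (γ δ : Deg n) (f g : R), f ∈ 𝒜 γ → g ∈ 𝒜 δ → f * g = sgn K (pair γ δ) • (g * f)

end Algebra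

section Pullback

variable {K V : Type*} [Field K] [AddCommGroup V] [Module K V] {n : ℕ}

/-- The pullback `∽[∼A, ∼B]^NR` of the Nijenhuis–Richardson bracket of `↓V`, `(↓V)^γ = V^{γ + α}`.
The isomorphism `∼A = ↓ ∘ A ∘ (↑, …, ↑)` does not change the underlying multilinear map, but it
turns the weight `A` into the weight `A + α a`. -/
def nrPullback (𝒱 : Deg n → Submodule K V) [DirectSum.Decomposition 𝒱] (α : Deg n) (m : ℕ)
    {p q : ℕ} (wA wB : Deg n) (A : Cochain K V p) (B : Cochain K V q) : Cochain K V m :=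
  nrBracket (desuspend 𝒱 α) m (biDeg α wA p) (biDeg α wB q) A B

/-- The pullback `∽[∼A, ∼B]^⊗` of the stem bracket of `↓V`, `(↓V)^γ = V^{γ + α}`. -/
def stemPullback [NeZero n] (𝒱 : Deg n → Submodule K V) [DirectSum.Decomposition 𝒱] (α : Deg n)
    {a b : ℕ} (wA wB : Deg n) (A : Cochain K V (a + 1)) (B : Cochain K V (b + 1)) :
    Cochain K V (a + b + 1) :=
  stemBracket (desuspend 𝒱 α) (biDeg α wA (a + 1)) (biDeg α wB (b + 1)) A B

end Pullback

end GradedBracket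

end

set_option linter.unusedSimpArgs false
set_option linter.unnecessarySeqFocus false
set_option linter.unusedTactic false

/-! All the maps are multilinear, so they may be compared on homogeneous arguments. There every
identity becomes an equality of powers of `-1`, that is, a parity check on integer exponents.

The bracket is the graded commutator of `□`, because both sides satisfy the same recursion in the
first argument (`gmBracket_eq_square`). Weight and `α`-antisymmetry already hold for `□`. The first
order property does not: already for one argument `□` is, up to sign, composition, which has order
two. The recursion reduces this property of the bracket to unary operators, where the bracket is
minus the graded commutator and the second order terms cancel (`isFirstOrder_commutator`).

Unrolling the recursion of `□` gives the sum over unshuffles: each step decides whether the first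
argument is fed to `B` (so `1 ∈ I`) or to `A` (so `1 ∈ J`), and in the second case antisymmetry of
`A` moves it past `B(v_I)` (`square_apply`). With degrees `v - α` the signs are those of the
Nijenhuis–Richardson insertion on the shifted space, which gives `gmBracket_eq_nrPullback`.

For the stem bracket, desuspension by `e₁` turns antisymmetric maps into symmetric ones. The
corestriction of `φ(A)φ(B)` inserts the output of `B` at each position of a word. Symmetry moves
that output to the front, so the triples `(I; J ∪ k₁; K \ k₁)` become pairs of unshuffles
(`corestriction_coderivation_comp`). Comparing signs before and after desuspension is the décalage
computation. It rests on a count of inversions (`sum_sub_succ_mul_unshuffle`) and gives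
`stemBracket_eq_nrBracket`. -/

namespace GradedBracket

/-! ### Signs and the pairing of degrees -/

section Signs

variable {K : Type*} [Field K] {n : ℕ}

theorem sgn_add (k l : ℤ) : sgn K (k + l) = sgn K k * sgn K l :=
  zpow_add₀ (by simp) k l

@[simp] theorem sgn_zero : sgn K 0 = 1 := zpow_zero _

@[simp] theorem sgn_one : sgn K 1 = -1 := zpow_one _

theorem sgn_mul_self (k : ℤ) : sgn K k * sgn K k = 1 := by
  rw [← sgn_add]; exact Even.neg_one_zpow ⟨k, rfl⟩

/-- Every later comparison of signs goes through this lemma: the exponents are added, the pairings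
are expanded bilinearly, and the parity of the resulting integer is decided with each pairing
treated as an unknown. -/
theorem sgn_eq_of_even {k l : ℤ} (h : Even (k + l)) : sgn K k = sgn K l := by
  have h1 : sgn K (k + l) = 1 := h.neg_one_zpow
  rw [sgn_add] at h1
  calc sgn K k = sgn K k * sgn K l * sgn K l := by rw [mul_assoc, sgn_mul_self, mul_one]
    _ = sgn K l := by rw [h1, one_mul]

theorem neg_sgn (k : ℤ) : -sgn K k = sgn K (k + 1) := by
  rw [sgn_add, sgn_one, mul_neg_one]

theorem sgn_sum {ι : Type*} (s : Finset ι) (f : ι → ℤ) :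
    sgn K (∑ i ∈ s, f i) = ∏ i ∈ s, sgn K (f i) := by
  induction s using Finset.cons_induction with
  | empty => simp
  | cons a s ha ih => rw [Finset.sum_cons, Finset.prod_cons, sgn_add, ih]

theorem pair_comm (x y : Deg n) : pair x y = pair y x := by
  simp [pair, mul_comm]

theorem pair_add_left (x y z : Deg n) : pair (x + y) z = pair x z + pair y z := by
  simp [pair, add_mul, Finset.sum_add_distrib]

theorem pair_add_right (x y z : Deg n) : pair x (y + z) = pair x y + pair x z := by
  simp [pair, mul_add, Finset.sum_add_distrib]

theorem pair_sub_left (x y z : Deg n) : pair (x - y) z = pair x z - pair y z := by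
  simp [pair, sub_mul, Finset.sum_sub_distrib]

theorem pair_sub_right (x y z : Deg n) : pair x (y - z) = pair x y - pair x z := by
  simp [pair, mul_sub, Finset.sum_sub_distrib]

theorem pair_smul_left (c : ℤ) (x y : Deg n) : pair (c • x) y = c * pair x y := by
  simp [pair, Finset.mul_sum, mul_assoc]

theorem pair_smul_right (c : ℤ) (x y : Deg n) : pair x (c • y) = c * pair x y := by
  simp [pair, Finset.mul_sum, mul_left_comm]

theorem pair_sum_left {ι : Type*} (s : Finset ι) (f : ι → Deg n) (y : Deg n) :
    pair (∑ i ∈ s, f i) y = ∑ i ∈ s, pair (f i) y := by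
  induction s using Finset.cons_induction with
  | empty => simp [pair]
  | cons a s ha ih => rw [Finset.sum_cons, Finset.sum_cons, pair_add_left, ih]

theorem pair_sum_right {ι : Type*} (s : Finset ι) (f : ι → Deg n) (y : Deg n) :
    pair y (∑ i ∈ s, f i) = ∑ i ∈ s, pair y (f i) := by
  simp only [pair_comm y, pair_sum_left]

end Signs

/-! ### Reduction to homogeneous arguments and recursion in the first argument -/

section Graded

variable {K V : Type*} [Field K] [AddCommGroup V] [Module K V] {n : ℕ}
variable {𝒱 : Deg n → Submodule K V}

/-- Multilinear maps which agree on homogeneous vectors are equal. -/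
theorem cochain_ext [DirectSum.Decomposition 𝒱] {p : ℕ} {A B : Cochain K V p}
    (h : ∀ (d : Fin p → Deg n) (v : Fin p → V), (∀ i, v i ∈ 𝒱 (d i)) → A v = B v) : A = B := by
  induction p with
  | zero => exact MultilinearMap.ext fun v => h Fin.elim0 v (fun i => i.elim0)
  | succ p ih =>
    refine (multilinearCurryLeftEquiv K (fun _ : Fin (p + 1) => V) V).injective ?_
    refine DirectSum.decompose_lhom_ext 𝒱 fun γ => LinearMap.ext fun u => ?_
    refine ih fun d v hv => ?_
    exact h (Fin.cons γ d) (Fin.cons u.1 v) (Fin.cases u.2 hv)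

theorem curryLeft_ext [DirectSum.Decomposition 𝒱] {p : ℕ} {A B : Cochain K V (p + 1)}
    (h : ∀ (γ : Deg n) (u : V), u ∈ 𝒱 γ → A.curryLeft u = B.curryLeft u) : A = B := by
  refine (multilinearCurryLeftEquiv K (fun _ : Fin (p + 1) => V) V).injective ?_
  exact DirectSum.decompose_lhom_ext 𝒱 fun γ => LinearMap.ext fun u => h γ u u.2

@[simp] theorem curryLeft_smul {p : ℕ} (c : K) (A : Cochain K V (p + 1)) (v : V) :
    (c • A).curryLeft v = c • A.curryLeft v := rfl

@[simp] theorem curryLeft_add {p : ℕ} (A B : Cochain K V (p + 1)) (v : V) :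
    (A + B).curryLeft v = A.curryLeft v + B.curryLeft v := rfl

@[simp] theorem curryLeft_sub {p : ℕ} (A B : Cochain K V (p + 1)) (v : V) :
    (A - B).curryLeft v = A.curryLeft v - B.curryLeft v := by
  ext; simp

@[simp] theorem curryLeft_zero {p : ℕ} (v : V) :
    (0 : Cochain K V (p + 1)).curryLeft v = 0 := rfl

theorem uncurry_curryLeft {m : ℕ} (f : V →ₗ[K] Cochain K V m) (v : V) :
    (uncurry m f).curryLeft v = f v := by
  ext w; simp [uncurry]

theorem recStep_curryLeft [DirectSum.Decomposition 𝒱] {m p q : ℕ}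
    (F : Deg n → Cochain K V (p + 1) →ₗ[K] Cochain K V q →ₗ[K] Cochain K V m)
    (G : Deg n → Cochain K V p →ₗ[K] Cochain K V (q + 1) →ₗ[K] Cochain K V m)
    (A : Cochain K V (p + 1)) (B : Cochain K V (q + 1)) {γ : Deg n} {v : V} (hv : v ∈ 𝒱 γ) :
    (recStep 𝒱 F G A B).curryLeft v = F γ A (B.curryLeft v) + G γ (A.curryLeft v) B := by
  change (uncurry m (homExtLinear 𝒱 _)).curryLeft v = _
  rw [uncurry_curryLeft, homExtLinear_apply 𝒱 _ hv]
  rfl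

/-! ### Weights and skew maps -/

theorem HasWeight.curryLeft {p : ℕ} {w : Deg n} {A : Cochain K V (p + 1)} (hA : HasWeight 𝒱 w A)
    {γ : Deg n} {v : V} (hv : v ∈ 𝒱 γ) : HasWeight 𝒱 (w + γ) (A.curryLeft v) := by
  intro d u hu
  have := hA (Fin.cons γ d) (Fin.cons v u) (Fin.cases hv hu)
  rwa [Fin.sum_univ_succ, Fin.cons_zero, ← add_assoc] at this

theorem hasWeight_of_curryLeft [DirectSum.Decomposition 𝒱] {p : ℕ} {w : Deg n}
    {A : Cochain K V (p + 1)}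
    (h : ∀ (γ : Deg n) (v : V), v ∈ 𝒱 γ → HasWeight 𝒱 (w + γ) (A.curryLeft v)) :
    HasWeight 𝒱 w A := by
  intro d u hu
  have := h (d 0) (u 0) (hu 0) (fun i => d i.succ) (fun i => u i.succ) (fun i => hu i.succ)
  rw [Fin.sum_univ_succ, ← add_assoc]
  rwa [MultilinearMap.curryLeft_apply, show (Fin.cons (u 0) fun i => u i.succ) = u from
    Fin.cons_self_tail u] at this

theorem HasWeight.add {p : ℕ} {w : Deg n} {A B : Cochain K V p} (hA : HasWeight 𝒱 w A)
    (hB : HasWeight 𝒱 w B) : HasWeight 𝒱 w (A + B) :=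
  fun d v hv => add_mem (hA d v hv) (hB d v hv)

theorem HasWeight.sub {p : ℕ} {w : Deg n} {A B : Cochain K V p} (hA : HasWeight 𝒱 w A)
    (hB : HasWeight 𝒱 w B) : HasWeight 𝒱 w (A - B) :=
  fun d v hv => sub_mem (hA d v hv) (hB d v hv)

theorem HasWeight.smul {p : ℕ} {w : Deg n} {A : Cochain K V p} (c : K) (hA : HasWeight 𝒱 w A) :
    HasWeight 𝒱 w (c • A) :=
  fun d v hv => Submodule.smul_mem _ c (hA d v hv)

theorem HasWeight.zero {p : ℕ} {w : Deg n} : HasWeight 𝒱 w (0 : Cochain K V p) :=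
  fun _ _ _ => zero_mem _

theorem HasWeight.mem {w : Deg n} {A : Cochain K V 0} (hA : HasWeight 𝒱 w A) (v : Fin 0 → V) :
    A v ∈ 𝒱 w := by
  have := hA Fin.elim0 v (fun i => i.elim0)
  rwa [Fin.sum_univ_zero, add_zero] at this

theorem IsAlphaSkew.add {p : ℕ} {α : Deg n} {A B : Cochain K V p} (hA : IsAlphaSkew 𝒱 α A)
    (hB : IsAlphaSkew 𝒱 α B) : IsAlphaSkew 𝒱 α (A + B) := by
  intro d v hv i j hij
  simp only [add_apply, hA d v hv i j hij, hB d v hv i j hij]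
  module

theorem IsAlphaSkew.sub {p : ℕ} {α : Deg n} {A B : Cochain K V p} (hA : IsAlphaSkew 𝒱 α A)
    (hB : IsAlphaSkew 𝒱 α B) : IsAlphaSkew 𝒱 α (A - B) := by
  intro d v hv i j hij
  simp only [sub_apply, hA d v hv i j hij, hB d v hv i j hij]
  module

theorem IsAlphaSkew.smul {p : ℕ} {α : Deg n} (c : K) {A : Cochain K V p}
    (hA : IsAlphaSkew 𝒱 α A) : IsAlphaSkew 𝒱 α (c • A) := by
  intro d v hv i j hij
  simp only [smul_apply, hA d v hv i j hij]
  module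

theorem IsAlphaSkew.zero {p : ℕ} {α : Deg n} : IsAlphaSkew 𝒱 α (0 : Cochain K V p) := by
  intro d v hv i j hij
  simp

theorem IsAlphaSkew.of_subsingleton {p : ℕ} (hp : p ≤ 1) {α : Deg n} (A : Cochain K V p) :
    IsAlphaSkew 𝒱 α A := by
  intro d v hv i j hij
  omega

theorem cons_comp_swap_succ {X : Type*} {p : ℕ} (x : X) (u : Fin p → X) (i j : Fin p) :
    (Fin.cons x u : Fin (p + 1) → X) ∘ Equiv.swap i.succ j.succ
      = Fin.cons x (u ∘ Equiv.swap i j) := by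
  funext k
  refine Fin.cases ?_ (fun k => ?_) k
  · rw [Function.comp_apply, Equiv.swap_apply_of_ne_of_ne (Fin.succ_ne_zero i).symm
      (Fin.succ_ne_zero j).symm, Fin.cons_zero, Fin.cons_zero]
  · rw [Function.comp_apply, ← (Fin.succ_injective p).map_swap, Fin.cons_succ, Fin.cons_succ]
    rfl

theorem IsAlphaSkew.curryLeft {p : ℕ} {α : Deg n} {A : Cochain K V (p + 1)}
    (hA : IsAlphaSkew 𝒱 α A) {γ : Deg n} {v : V} (hv : v ∈ 𝒱 γ) :
    IsAlphaSkew 𝒱 α (A.curryLeft v) := by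
  intro d u hu i j hij
  have := hA (Fin.cons γ d) (Fin.cons v u) (Fin.cases hv hu) i.succ j.succ (by simpa using hij)
  rwa [cons_comp_swap_succ] at this

theorem cons_cons_comp_swap {X : Type*} {p : ℕ} (x y : X) (u : Fin p → X) :
    (Fin.cons x (Fin.cons y u : Fin (p + 1) → X) : Fin (p + 2) → X) ∘ Equiv.swap 0 1
      = Fin.cons y (Fin.cons x u : Fin (p + 1) → X) := by
  funext k
  refine Fin.cases ?_ (fun k => Fin.cases ?_ (fun k => ?_) k) k
  · rw [Function.comp_apply, Equiv.swap_apply_left]; rfl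
  · rw [Function.comp_apply, show Fin.succ (0 : Fin (p + 1)) = 1 from rfl,
      Equiv.swap_apply_right]; rfl
  · rw [Function.comp_apply, Equiv.swap_apply_of_ne_of_ne (Fin.succ_ne_zero _)
      (fun h : k.succ.succ = 1 => Fin.succ_ne_zero k (Fin.succ_injective _ h))]
    rfl

theorem IsAlphaSkew.curryLeft_comm [DirectSum.Decomposition 𝒱] {p : ℕ} {α : Deg n}
    {A : Cochain K V (p + 2)} (hA : IsAlphaSkew 𝒱 α A) {γ δ : Deg n} {u v : V}
    (hu : u ∈ 𝒱 γ) (hv : v ∈ 𝒱 δ) :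
    (A.curryLeft v).curryLeft u = -(sgn K (pair (γ + α) (δ + α)) • (A.curryLeft u).curryLeft v) := by
  refine cochain_ext (𝒱 := 𝒱) fun d w hw => ?_
  have := hA (Fin.cons γ (Fin.cons δ d : Fin (p + 1) → Deg n))
    (Fin.cons u (Fin.cons v w : Fin (p + 1) → V)) (Fin.cases hu (Fin.cases hv hw)) 0 1 rfl
  rwa [cons_cons_comp_swap] at this

/-- A neighbouring swap either avoids the first slot, and then acts inside a value `A(v)`, or
exchanges the first two slots. This makes antisymmetry accessible to induction on the number of
arguments. -/
theorem isAlphaSkew_of_curryLeft {p : ℕ} {α : Deg n} {A : Cochain K V (p + 2)}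
    (h : ∀ (γ : Deg n) (v : V), v ∈ 𝒱 γ → IsAlphaSkew 𝒱 α (A.curryLeft v))
    (h' : ∀ (γ δ : Deg n) (u v : V), u ∈ 𝒱 γ → v ∈ 𝒱 δ →
      (A.curryLeft v).curryLeft u =
        -(sgn K (pair (γ + α) (δ + α)) • (A.curryLeft u).curryLeft v)) :
    IsAlphaSkew 𝒱 α A := by
  intro d v hv i j hij
  obtain ⟨x, v, rfl⟩ : ∃ x w, v = Fin.cons x w := ⟨v 0, Fin.tail v, (Fin.cons_self_tail v).symm⟩
  obtain ⟨i, rfl⟩ | rfl := (i.eq_zero_or_eq_succ).symm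
  · obtain ⟨j, rfl⟩ := Fin.exists_succ_eq.2 (show j ≠ 0 by rintro rfl; simp at hij)
    rw [cons_comp_swap_succ]
    exact h (d 0) x (hv 0) (fun k => d k.succ) v (fun k => hv k.succ) i j (by simpa using hij)
  · obtain rfl : j = 1 := Fin.ext (by simpa using hij.symm)
    obtain ⟨y, v, rfl⟩ : ∃ y w, v = Fin.cons y w :=
      ⟨v 0, Fin.tail v, (Fin.cons_self_tail v).symm⟩
    rw [cons_cons_comp_swap]
    exact congrArg (fun B : Cochain K V p => B v) (h' (d 0) (d 1) x y (hv 0) (hv 1))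

/-! ### The square product -/

variable [DirectSum.Decomposition 𝒱] {α : Deg n}

theorem square_zero_left (m q : ℕ) (h : 0 + q = m + 1) (wA wB : Deg n) (A : Cochain K V 0)
    (B : Cochain K V q) : square 𝒱 α m 0 q h wA wB A B = 0 := by
  cases q with
  | zero => omega
  | succ q => unfold square; rfl

theorem square_zero_right (m : ℕ) (h : m + 1 + 0 = m + 1) (wA wB : Deg n)
    (A : Cochain K V (m + 1)) (B : Cochain K V 0) :
    square 𝒱 α m (m + 1) 0 h wA wB A B = sgn K (1 - (m : ℤ)) • A.curryLeft (B Fin.elim0) := by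
  unfold square; rfl

theorem square_curryLeft (m a b : ℕ) (h : a + 1 + (b + 1) = m + 1 + 1) (wA wB : Deg n)
    (A : Cochain K V (a + 1)) (B : Cochain K V (b + 1)) {γ : Deg n} {v : V} (hv : v ∈ 𝒱 γ) :
    (square 𝒱 α (m + 1) (a + 1) (b + 1) h wA wB A B).curryLeft v =
      sgn K (a : ℤ) • square 𝒱 α m (a + 1) b (by omega) wA (wB + γ) A (B.curryLeft v) +
      sgn K (pair (biDeg α wB (b + 1)) (γ - α)) •
        square 𝒱 α m a (b + 1) (by omega) (wA + γ) wB (A.curryLeft v) B := by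
  -- The fifth equation is the genuinely recursive clause, where both maps have at least one
  -- argument.
  rw [square.eq_5, recStep_curryLeft _ _ _ _ hv]; rfl

theorem gmBracket_zero_left (m : ℕ) (h : 0 + (m + 1) = m + 1) (wA wB : Deg n)
    (A : Cochain K V 0) (B : Cochain K V (m + 1)) :
    gmBracket 𝒱 α m 0 (m + 1) h wA wB A B =
      (-sgn K (pair (wA - α) (biDeg α wB (m + 1)) + m)) • sgn K (1 - (m : ℤ)) •
        B.curryLeft (A Fin.elim0) := by
  unfold gmBracket; rfl

theorem gmBracket_zero_right (m : ℕ) (h : m + 1 + 0 = m + 1) (wA wB : Deg n)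
    (A : Cochain K V (m + 1)) (B : Cochain K V 0) :
    gmBracket 𝒱 α m (m + 1) 0 h wA wB A B = sgn K (1 - (m : ℤ)) • A.curryLeft (B Fin.elim0) := by
  unfold gmBracket; rfl

theorem gmBracket_curryLeft (m a b : ℕ) (h : a + 1 + (b + 1) = m + 1 + 1) (wA wB : Deg n)
    (A : Cochain K V (a + 1)) (B : Cochain K V (b + 1)) {γ : Deg n} {v : V} (hv : v ∈ 𝒱 γ) :
    (gmBracket 𝒱 α (m + 1) (a + 1) (b + 1) h wA wB A B).curryLeft v =
      sgn K (a : ℤ) • gmBracket 𝒱 α m (a + 1) b (by omega) wA (wB + γ) A (B.curryLeft v) +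
      sgn K (pair (biDeg α wB (b + 1)) (γ - α)) •
        gmBracket 𝒱 α m a (b + 1) (by omega) (wA + γ) wB (A.curryLeft v) B := by
  rw [gmBracket.eq_5, recStep_curryLeft _ _ _ _ hv]; rfl

end Graded

/-! ### Weight and antisymmetry of the square product; the bracket as its commutator -/

section Graded

variable {K V : Type*} [Field K] [AddCommGroup V] [Module K V] {n : ℕ}
variable {𝒱 : Deg n → Submodule K V} [DirectSum.Decomposition 𝒱] {α : Deg n}

theorem square_hasWeight {m p q : ℕ} (h : p + q = m + 1) {wA wB : Deg n}
    {A : Cochain K V p} {B : Cochain K V q} (hA : HasWeight 𝒱 wA A) (hB : HasWeight 𝒱 wB B) :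
    HasWeight 𝒱 (wA + wB) (square 𝒱 α m p q h wA wB A B) := by
  induction m generalizing p q wA wB with
  | zero =>
    rcases p with _ | a
    · rw [square_zero_left]; exact .zero
    · obtain rfl : a = 0 := by omega
      obtain rfl : q = 0 := by omega
      rw [square_zero_right]; exact (hA.curryLeft (hB.mem _)).smul _
  | succ m ih =>
    rcases p with _ | a
    · rw [square_zero_left]; exact .zero
    rcases q with _ | b
    · obtain rfl : a = m + 1 := by omega
      rw [square_zero_right]; exact (hA.curryLeft (hB.mem _)).smul _
    refine hasWeight_of_curryLeft fun γ v hv => ?_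
    rw [square_curryLeft _ _ _ _ _ _ _ _ hv]
    refine .add (.smul _ ?_) (.smul _ ?_)
    · rw [add_assoc]; exact ih _ hA (hB.curryLeft hv)
    · rw [add_right_comm]; exact ih _ (hA.curryLeft hv) hB

/-- Expanding twice in the first two arguments `u`, `v` gives four terms: both arguments in `B`,
both in `A`, and two mixed ones. The pure terms change sign by antisymmetry of `B` and of `A`; the
mixed ones are exchanged with each other. Swaps beyond the first slot are covered by induction. -/
theorem square_isAlphaSkew {m p q : ℕ} (h : p + q = m + 1) {wA wB : Deg n}
    {A : Cochain K V p} {B : Cochain K V q} (hA : HasWeight 𝒱 wA A) (hB : HasWeight 𝒱 wB B)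
    (hA' : IsAlphaSkew 𝒱 α A) (hB' : IsAlphaSkew 𝒱 α B) :
    IsAlphaSkew 𝒱 α (square 𝒱 α m p q h wA wB A B) := by
  induction m generalizing p q wA wB with
  | zero => exact .of_subsingleton (by omega) _
  | succ m ih =>
    rcases p with _ | a
    · rw [square_zero_left]; exact .zero
    rcases q with _ | b
    · obtain rfl : a = m + 1 := by omega
      rw [square_zero_right]; exact (hA'.curryLeft (hB.mem _)).smul _
    rcases m with _ | m
    · exact .of_subsingleton (by omega) _
    refine isAlphaSkew_of_curryLeft (fun γ v hv => ?_) (fun γ δ u v hu hv => ?_)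
    · rw [square_curryLeft _ _ _ _ _ _ _ _ hv]
      exact .add (.smul _ (ih _ hA (hB.curryLeft hv) hA' (hB'.curryLeft hv)))
        (.smul _ (ih _ (hA.curryLeft hv) hB (hA'.curryLeft hv) hB'))
    rw [square_curryLeft _ _ _ _ _ _ _ _ hu, square_curryLeft _ _ _ _ _ _ _ _ hv]
    simp only [curryLeft_add, curryLeft_smul]
    -- If `A` is unary, `A(u)` is a vector and `A(u) □ -` vanishes, so only the term with both
    -- arguments in `B` is left.
    rcases a with _ | a
    · obtain rfl : b = m + 1 := by omega
      simp only [square_zero_left, curryLeft_zero, smul_zero, add_zero]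
      rw [square_curryLeft _ _ _ _ _ _ _ _ hu, square_curryLeft _ _ _ _ _ _ _ _ hv]
      simp only [square_zero_left, smul_zero, add_zero]
      rw [hB'.curryLeft_comm hu hv]
      simp only [map_neg, map_smul]
      rw [add_right_comm wB δ γ]
      module
    -- If `B` is unary, `B(v)` is a vector inserted directly into `A`. The mixed terms are then
    -- compared by antisymmetry of `A` with `B(u)` or `B(v)` as one of the two exchanged arguments.
    rcases b with _ | b
    · obtain rfl : a = m := by omega
      simp only [square_zero_right]
      rw [square_curryLeft _ _ _ _ _ _ _ _ hu, square_curryLeft _ _ _ _ _ _ _ _ hv]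
      simp only [square_zero_right, curryLeft_smul]
      rw [hA'.curryLeft_comm hu hv, hA'.curryLeft_comm hu ((hB.curryLeft hv).mem _),
        hA'.curryLeft_comm ((hB.curryLeft hu).mem Fin.elim0) hv, add_right_comm wA δ γ]
      simp only [map_neg, LinearMap.neg_apply, map_smul, LinearMap.smul_apply]
      match_scalars <;> (
        (try simp only [one_mul, mul_one, neg_mul, mul_neg, ← sgn_add, neg_sgn, neg_neg,
          zero_add, add_zero, zero_sub]) <;>
        refine sgn_eq_of_even ?_ <;> rw [Int.even_iff] <;>
        (try simp only [biDeg, pair_add_left, pair_add_right, pair_sub_left, pair_sub_right,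
          pair_smul_left, pair_smul_right, Nat.cast_add, Nat.cast_one, Nat.cast_zero,
          Nat.cast_ofNat]) <;>
        (try simp only [pair_comm]) <;> ring_nf <;> omega)
    rw [square_curryLeft _ _ _ _ _ _ _ _ hu, square_curryLeft _ _ _ _ _ _ _ _ hv,
      square_curryLeft _ _ _ _ _ _ _ _ hu, square_curryLeft _ _ _ _ _ _ _ _ hv,
      hA'.curryLeft_comm hu hv, hB'.curryLeft_comm hu hv,
      add_right_comm wA δ γ, add_right_comm wB δ γ]
    simp only [map_neg, LinearMap.neg_apply, map_smul, LinearMap.smul_apply]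
    match_scalars <;> (
      (try simp only [one_mul, mul_one, neg_mul, mul_neg, ← sgn_add, neg_sgn, neg_neg,
        zero_add, add_zero, zero_sub]) <;>
      refine sgn_eq_of_even ?_ <;> rw [Int.even_iff] <;>
      (try simp only [biDeg, pair_add_left, pair_add_right, pair_sub_left, pair_sub_right,
        pair_smul_left, pair_smul_right, Nat.cast_add, Nat.cast_one, Nat.cast_zero,
        Nat.cast_ofNat]) <;>
      (try simp only [pair_comm]) <;> ring_nf <;> omega)

/-- Evaluating the commutator at `v` regroups it into the commutators of `A` with `B(v)` and of
`A(v)` with `B`, with the coefficients of the bracket recursion. No antisymmetry enters; the base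
cases are the insertions of a vector. -/
theorem gmBracket_eq_square {m p q : ℕ} (h : p + q = m + 1) (wA wB : Deg n)
    (A : Cochain K V p) (B : Cochain K V q) :
    gmBracket 𝒱 α m p q h wA wB A B = square 𝒱 α m p q h wA wB A B -
      sgn K (pair (biDeg α wA p) (biDeg α wB q) + ((p : ℤ) - 1) * ((q : ℤ) - 1)) •
        square 𝒱 α m q p ((Nat.add_comm q p).trans h) wB wA B A := by
  induction m generalizing p q wA wB with
  | zero =>
    rcases p with _ | a
    · obtain rfl : q = 1 := by omega
      rw [square_zero_left, gmBracket_zero_left, square_zero_right]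
      match_scalars <;> (
        (try simp only [one_mul, mul_one, neg_mul, mul_neg, ← sgn_add, neg_sgn, neg_neg,
          zero_add, add_zero, zero_sub]) <;>
        refine sgn_eq_of_even ?_ <;> rw [Int.even_iff] <;>
        (try simp only [biDeg, pair_add_left, pair_add_right, pair_sub_left, pair_sub_right,
          pair_smul_left, pair_smul_right, Nat.cast_add, Nat.cast_one, Nat.cast_zero,
          Nat.cast_ofNat]) <;>
        (try simp only [pair_comm]) <;> ring_nf <;> omega)
    · obtain rfl : a = 0 := by omega
      obtain rfl : q = 0 := by omega
      rw [square_zero_left, gmBracket_zero_right, square_zero_right]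
      simp
  | succ m ih =>
    rcases p with _ | a
    · obtain rfl : q = m + 2 := by omega
      rw [square_zero_left, gmBracket_zero_left, square_zero_right]
      match_scalars <;> (
        (try simp only [one_mul, mul_one, neg_mul, mul_neg, ← sgn_add, neg_sgn, neg_neg,
          zero_add, add_zero, zero_sub]) <;>
        refine sgn_eq_of_even ?_ <;> rw [Int.even_iff] <;>
        (try simp only [biDeg, pair_add_left, pair_add_right, pair_sub_left, pair_sub_right,
          pair_smul_left, pair_smul_right, Nat.cast_add, Nat.cast_one, Nat.cast_zero,
          Nat.cast_ofNat]) <;>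
        (try simp only [pair_comm]) <;> ring_nf <;> omega)
    rcases q with _ | b
    · obtain rfl : a = m + 1 := by omega
      rw [square_zero_left, gmBracket_zero_right, square_zero_right]
      simp
    refine curryLeft_ext (𝒱 := 𝒱) fun γ v hv => ?_
    rw [gmBracket_curryLeft _ _ _ _ _ _ _ _ hv, curryLeft_sub, curryLeft_smul,
      square_curryLeft _ _ _ _ _ _ _ _ hv, square_curryLeft _ _ _ _ _ _ _ _ hv, ih, ih]
    match_scalars <;> (
      (try simp only [one_mul, mul_one, neg_mul, mul_neg, ← sgn_add, neg_sgn, neg_neg,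
        zero_add, add_zero, zero_sub]) <;>
      refine sgn_eq_of_even ?_ <;> rw [Int.even_iff] <;>
      (try simp only [biDeg, pair_add_left, pair_add_right, pair_sub_left, pair_sub_right,
        pair_smul_left, pair_smul_right, Nat.cast_add, Nat.cast_one, Nat.cast_zero,
        Nat.cast_ofNat]) <;>
      (try simp only [pair_comm]) <;> ring_nf <;> omega)

end Graded

theorem sgn_eq_one_or {K : Type*} [Field K] (k : ℤ) : sgn K k = 1 ∨ sgn K k = -1 :=
  mul_self_eq_one_iff.1 (sgn_mul_self k)

/-! ### First order operators -/

section Algebra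

variable {K R : Type*} [Field K] [Ring R] [Algebra K R] {n : ℕ}
variable {𝒜 : Deg n → Submodule K R}

theorem IsFirstOrder.smul {p : ℕ} {w : Deg n} (c : K) {A : Cochain K R p}
    (hA : IsFirstOrder 𝒜 p w A) : IsFirstOrder 𝒜 p w (c • A) := by
  induction p generalizing w with
  | zero => trivial
  | succ p ih =>
    rcases p with _ | p
    · intro γ f g hf
      simp only [smul_apply, hA γ f g hf, smul_mul_assoc, mul_smul_comm]
      module
    · exact fun γ v hv => ih (hA γ v hv)

theorem IsFirstOrder.add {p : ℕ} {w : Deg n} {A B : Cochain K R p}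
    (hA : IsFirstOrder 𝒜 p w A) (hB : IsFirstOrder 𝒜 p w B) : IsFirstOrder 𝒜 p w (A + B) := by
  induction p generalizing w with
  | zero => trivial
  | succ p ih =>
    rcases p with _ | p
    · intro γ f g hf
      simp only [add_apply, hA γ f g hf, hB γ f g hf, add_mul, mul_add]
      module
    · exact fun γ v hv => ih (hA γ v hv) (hB γ v hv)

theorem IsFirstOrder.curryLeft {p : ℕ} {w : Deg n} {A : Cochain K R (p + 1)}
    (hA : IsFirstOrder 𝒜 (p + 1) w A) {γ : Deg n} {v : R} (hv : v ∈ 𝒜 γ) :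
    IsFirstOrder 𝒜 p (w + γ) (A.curryLeft v) := by
  rcases p with _ | p
  · trivial
  · exact hA γ v hv

theorem IsDiff₁.curryLeft {α : Deg n} {p : ℕ} {w : Deg n} {A : Cochain K R (p + 1)}
    (hA : IsDiff₁ 𝒜 α (p + 1) w A) {γ : Deg n} {v : R} (hv : v ∈ 𝒜 γ) :
    IsDiff₁ 𝒜 α p (w + γ) (A.curryLeft v) :=
  ⟨hA.weight.curryLeft hv, hA.skew.curryLeft hv, hA.firstOrder.curryLeft hv⟩

/-- The graded commutator of two first order operators is a first order operator. -/
theorem isFirstOrder_commutator [GradedAlgebra 𝒜] (hcomm : IsGradedComm 𝒜) {wA wB : Deg n}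
    {A B C : Cochain K R 1} (hA : HasWeight 𝒜 wA A) (hB : HasWeight 𝒜 wB B)
    (hA' : IsFirstOrder 𝒜 1 wA A) (hB' : IsFirstOrder 𝒜 1 wB B)
    (hC : ∀ v, C (fun _ => v) =
      A (fun _ => B (fun _ => v)) - sgn K (pair wA wB) • B (fun _ => A (fun _ => v))) :
    IsFirstOrder 𝒜 1 (wA + wB) C := by
  intro γ f g hf
  have mem {w γ : Deg n} {D : Cochain K R 1} {f : R} (hD : HasWeight 𝒜 w D) (hf : f ∈ 𝒜 γ) :
      D (fun _ => f) ∈ 𝒜 (w + γ) := by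
    simpa using hD (fun _ => γ) (fun _ => f) (fun _ => hf)
  have upd (x : R) : Function.update (fun _ : Fin 1 => (0 : R)) 0 x = fun _ => x := by
    funext i; simp [Subsingleton.elim i 0]
  have add' (D : Cochain K R 1) (x y : R) :
      D (fun _ => x + y) = D (fun _ => x) + D (fun _ => y) := by
    simpa only [upd] using (D.map_update_add (fun _ => 0) 0 x y)
  have smul' (D : Cochain K R 1) (c : K) (x : R) : D (fun _ => c • x) = c • D (fun _ => x) := by
    simpa only [upd] using (D.map_update_smul (fun _ => 0) 0 c x)
  have sub' (D : Cochain K R 1) (x y : R) :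
      D (fun _ => x - y) = D (fun _ => x) - D (fun _ => y) := by
    rw [sub_eq_add_neg, ← neg_one_smul K y, add', smul', neg_one_smul, sub_eq_add_neg]
  have one : (1 : R) ∈ 𝒜 0 := SetLike.GradedOne.one_mem
  have hA1 : A (fun _ => 1) ∈ 𝒜 wA := by simpa using mem hA one
  have hB1 : B (fun _ => 1) ∈ 𝒜 wB := by simpa using mem hB one
  -- The term `B(1) f g` produced by `B(f g)` is expanded again by `A` with first factor `B(1) f`,
  -- and symmetrically with `A` and `B` interchanged. These products must therefore be homogeneous.
  have hAf1 := SetLike.GradedMul.mul_mem hA1 hf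
  have hBf1 := SetLike.GradedMul.mul_mem hB1 hf
  simp only [hC, hB' γ f g hf, hA' γ f g hf, add', sub', smul', hA' _ _ g (mem hB hf),
    hB' _ _ g (mem hA hf), hA' _ _ g hBf1, hB' _ _ g hAf1, hA' γ f _ hf, hB' γ f _ hf,
    hA' _ _ f hB1, hB' _ _ f hA1]
  simp only [add_mul, sub_mul, pair_add_left, pair_add_right, sgn_add,
    pair_comm wB wA]
  -- The terms that do not cancel formally are `A(1) B(1) f g` and `B(1) A(1) f g`. Each occurs
  -- twice, because `B(1) f g` is a product of three factors and `A` is applied to two products in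
  -- turn. Graded commutativity is needed only for `A(1)` and `B(1)`.
  have hab := congrArg (· * (f * g)) (hcomm _ _ _ _ hA1 hB1)
  rcases sgn_eq_one_or (K := K) (pair wA wB) with h1 | h1 <;>
  rcases sgn_eq_one_or (K := K) (pair wA γ) with h2 | h2 <;>
  rcases sgn_eq_one_or (K := K) (pair wB γ) with h3 | h3 <;>
  simp only [h1, h2, h3, one_mul, neg_mul, mul_neg, mul_one, neg_neg, one_smul, neg_smul] at hab ⊢ <;>
  linear_combination (norm := noncomm_ring) 2 * hab

/-- With at least two arguments left, the first order condition is a condition on the values, which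
are brackets of the same kind. Only the bracket of two unary operators needs a computation. -/
theorem gmBracket_isFirstOrder [GradedAlgebra 𝒜] (hcomm : IsGradedComm 𝒜) {α : Deg n}
    {m p q : ℕ} (h : p + q = m + 1) {wA wB : Deg n} {A : Cochain K R p} {B : Cochain K R q}
    (hA : IsDiff₁ 𝒜 α p wA A) (hB : IsDiff₁ 𝒜 α q wB B) :
    IsFirstOrder 𝒜 m (wA + wB) (gmBracket 𝒜 α m p q h wA wB A B) := by
  induction m generalizing p q wA wB with
  | zero => trivial
  | succ m ih =>
    rcases p with _ | a
    · obtain rfl : q = m + 2 := by omega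
      rw [gmBracket_zero_left, add_comm wA wB]
      exact .smul _ (.smul _ (hB.firstOrder.curryLeft (hA.weight.mem _)))
    rcases q with _ | b
    · obtain rfl : a = m + 1 := by omega
      rw [gmBracket_zero_right]
      exact .smul _ (hA.firstOrder.curryLeft (hB.weight.mem _))
    rcases m with _ | m
    · obtain rfl : a = 0 := by omega
      obtain rfl : b = 0 := by omega
      let L (D : Cochain K R 1) : R →ₗ[K] R := (MultilinearMap.ofSubsingleton K R R 0).symm D
      let C : Cochain K R 1 := MultilinearMap.ofSubsingleton K R R 0
        (L A ∘ₗ L B - sgn K (pair wA wB) • L B ∘ₗ L A)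
      have hC (v : R) : C (fun _ => v) =
          A (fun _ => B (fun _ => v)) - sgn K (pair wA wB) • B (fun _ => A (fun _ => v)) := rfl
      -- For unary operators `biDeg` is the weight itself, and the two occurrences of `γ - α` in the
      -- signs cancel modulo 2. What is left is minus the ordinary graded commutator.
      have key : gmBracket 𝒜 α 1 1 1 h wA wB A B = sgn K 1 • C := by
        refine curryLeft_ext (𝒱 := 𝒜) fun γ v hv => ?_
        rw [gmBracket_curryLeft _ _ _ _ _ _ _ _ hv, gmBracket_zero_right, gmBracket_zero_left]
        ext u
        have e (D : Cochain K R 1) (x : R) : (D.curryLeft x) u = D (fun _ => x) := by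
          rw [MultilinearMap.curryLeft_apply]
          exact congrArg D (funext fun i => by rw [Subsingleton.elim (α := Fin 1) i 0]; rfl)
        have e' (D : Cochain K R 1) (x : R) : (D.curryLeft x) Fin.elim0 = D (fun _ => x) := by
          rw [MultilinearMap.curryLeft_apply]
          exact congrArg D (funext fun i => by rw [Subsingleton.elim (α := Fin 1) i 0]; rfl)
        simp only [add_apply, smul_apply, curryLeft_smul, e, e', hC]
        match_scalars <;> (
          (try simp only [one_mul, mul_one, neg_mul, mul_neg, ← sgn_add, neg_sgn, neg_neg,
            zero_add, add_zero, zero_sub]) <;>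
          refine sgn_eq_of_even ?_ <;> rw [Int.even_iff] <;>
          (try simp only [biDeg, pair_add_left, pair_add_right, pair_sub_left, pair_sub_right,
            pair_smul_left, pair_smul_right, Nat.cast_add, Nat.cast_one, Nat.cast_zero,
            Nat.cast_ofNat]) <;>
          (try simp only [pair_comm]) <;> ring_nf <;> omega)
      rw [key]
      exact .smul _ (isFirstOrder_commutator hcomm hA.weight hB.weight hA.firstOrder
        hB.firstOrder hC)
    · intro γ v hv
      rw [gmBracket_curryLeft _ _ _ _ _ _ _ _ hv]
      refine .add (.smul _ ?_) (.smul _ ?_)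
      · rw [add_assoc]; exact ih _ hA (hB.curryLeft hv)
      · rw [add_right_comm]; exact ih _ (hA.curryLeft hv) hB

end Algebra

/-! ### Recursion on unshuffles by the block containing the first index -/

section Unshuffles

/-- The extension of a bijection `γ ≃ Fin m` to `β ≃ Fin (m + 1)`, where `β` is `γ` with one
additional element, which is sent to `0`. -/
def extendEquiv {β γ : Type*} (E : β ≃ Option γ) {m : ℕ} (σ : γ ≃ Fin m) : β ≃ Fin (m + 1) :=
  E.trans (σ.optionCongr.trans (finSuccEquiv m).symm)

theorem extendEquiv_none {β γ : Type*} (E : β ≃ Option γ) {m : ℕ} (σ : γ ≃ Fin m) {b : β}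
    (hb : E b = none) : extendEquiv E σ b = 0 := by
  simp [extendEquiv, hb]

theorem extendEquiv_some {β γ : Type*} (E : β ≃ Option γ) {m : ℕ} (σ : γ ≃ Fin m) {b : β} {c : γ}
    (hb : E b = some c) : extendEquiv E σ b = (σ c).succ := by
  simp [extendEquiv, hb]

theorem extendEquiv_injective {β γ : Type*} (E : β ≃ Option γ) {m : ℕ} :
    Function.Injective (extendEquiv E (m := m)) := by
  intro σ τ h
  refine Equiv.ext fun c => ?_
  have := congrArg (fun e : β ≃ Fin (m + 1) => e (E.symm (some c))) h
  simpa [extendEquiv_some E _ (E.apply_symm_apply (some c))] using this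

theorem exists_extendEquiv_eq {β γ : Type*} (E : β ≃ Option γ) {m : ℕ} (τ : β ≃ Fin (m + 1))
    {b : β} (hb : E b = none) (h0 : τ b = 0) : ∃ σ, extendEquiv E σ = τ := by
  -- Read through `E` and `finSuccEquiv`, the bijection `τ` matches the two added points, so
  -- deleting them leaves the required `σ`.
  let e : Option γ ≃ Option (Fin m) := E.symm.trans (τ.trans (finSuccEquiv m))
  have he : e none = none := by simp [e, ← hb, h0]
  refine ⟨Equiv.removeNone e, Equiv.ext fun x => ?_⟩
  rcases hx : E x with _ | c
  · rw [extendEquiv_none E _ hx, ← h0, E.injective (hb.trans hx.symm)]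
  · rw [extendEquiv_some E _ hx]
    have h1 : ∃ y, e (some c) = some y :=
      Option.ne_none_iff_exists'.1 fun h => Option.some_ne_none c (e.injective (h.trans he.symm))
    have h2 := Equiv.removeNone_some e h1
    rw [← finSuccEquiv_symm_some, h2]
    simp [e, ← hx]

/-- Removal of the first element of the left block. -/
def finSuccSum (q a : ℕ) : Fin (q + 1) ⊕ Fin a ≃ Option (Fin q ⊕ Fin a) where
  toFun := Sum.elim (Fin.cases none fun x => some (Sum.inl x)) fun y => some (Sum.inr y)
  invFun z := z.elim (Sum.inl 0) (Sum.map Fin.succ id)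
  left_inv := by
    rintro (x | y)
    · refine Fin.cases rfl (fun x => rfl) x
    · rfl
  right_inv := by rintro (_ | _ | _) <;> rfl

/-- Removal of the first element of the right block. -/
def sumFinSucc (q a : ℕ) : Fin q ⊕ Fin (a + 1) ≃ Option (Fin q ⊕ Fin a) where
  toFun := Sum.elim (fun x => some (Sum.inl x)) (Fin.cases none fun y => some (Sum.inr y))
  invFun z := z.elim (Sum.inr 0) (Sum.map id Fin.succ)
  left_inv := by
    rintro (x | y)
    · rfl
    · refine Fin.cases rfl (fun x => rfl) y
  right_inv := by rintro (_ | _ | _) <;> rfl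

theorem strictMono_fin_succ_iff {q m : ℕ} {f : Fin (q + 1) → Fin (m + 1)} {g : Fin q → Fin m}
    (h0 : f 0 = 0) (hs : ∀ x, f x.succ = (g x).succ) : StrictMono f ↔ StrictMono g := by
  constructor
  · intro hf x y hxy
    have := hf (Fin.succ_lt_succ_iff.2 hxy)
    rwa [hs, hs, Fin.succ_lt_succ_iff] at this
  · intro hg x y
    refine Fin.cases (fun h => ?_) (fun y => ?_) y
    · exact absurd h (Fin.not_lt_zero _)
    · refine Fin.cases (fun _ => ?_) (fun x h => ?_) x
      · rw [h0, hs]; exact Fin.succ_pos _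
      · rw [hs, hs, Fin.succ_lt_succ_iff]; exact hg (Fin.succ_lt_succ_iff.1 h)

theorem strictMono_succ_comp_iff {q m : ℕ} {f : Fin q → Fin (m + 1)} {g : Fin q → Fin m}
    (hs : ∀ x, f x = (g x).succ) : StrictMono f ↔ StrictMono g := by
  obtain rfl : f = fun x => (g x).succ := funext hs
  exact ⟨fun h x y hxy => Fin.succ_lt_succ_iff.1 (h hxy),
    fun h x y hxy => Fin.succ_lt_succ_iff.2 (h hxy)⟩

theorem mem_unshuffles {i j m : ℕ} {σ : Fin i ⊕ Fin j ≃ Fin m} :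
    σ ∈ unshuffles i j m ↔
      StrictMono (fun x => σ (Sum.inl x)) ∧ StrictMono (fun y => σ (Sum.inr y)) := by
  simp [unshuffles]

theorem extendEquiv_finSuccSum_mem {q a m : ℕ} {σ : Fin q ⊕ Fin a ≃ Fin m} :
    extendEquiv (finSuccSum q a) σ ∈ unshuffles (q + 1) a (m + 1) ↔ σ ∈ unshuffles q a m := by
  rw [mem_unshuffles, mem_unshuffles,
    strictMono_fin_succ_iff (f := fun x => extendEquiv (finSuccSum q a) σ (Sum.inl x))
      (extendEquiv_none _ _ rfl) (fun x => extendEquiv_some _ _ rfl),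
    strictMono_succ_comp_iff (fun x => extendEquiv_some _ _ rfl)]

theorem extendEquiv_sumFinSucc_mem {q a m : ℕ} {σ : Fin q ⊕ Fin a ≃ Fin m} :
    extendEquiv (sumFinSucc q a) σ ∈ unshuffles q (a + 1) (m + 1) ↔ σ ∈ unshuffles q a m := by
  rw [mem_unshuffles, mem_unshuffles,
    strictMono_fin_succ_iff (f := fun y => extendEquiv (sumFinSucc q a) σ (Sum.inr y))
      (extendEquiv_none _ _ rfl) (fun x => extendEquiv_some _ _ rfl),
    strictMono_succ_comp_iff (fun x => extendEquiv_some _ _ rfl)]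

variable {M : Type*} [AddCommMonoid M]

theorem sum_unshuffles_inl_zero {q a m : ℕ} (G : (Fin (q + 1) ⊕ Fin a ≃ Fin (m + 1)) → M) :
    ∑ τ ∈ unshuffles (q + 1) a (m + 1) with τ (Sum.inl 0) = 0, G τ =
      ∑ σ ∈ unshuffles q a m, G (extendEquiv (finSuccSum q a) σ) := by
  symm
  refine Finset.sum_bij (fun σ _ => extendEquiv (finSuccSum q a) σ) (fun σ hσ => ?_)
    (fun σ _ τ _ h => extendEquiv_injective _ h) (fun τ hτ => ?_) (fun _ _ => rfl)
  · rw [Finset.mem_filter, extendEquiv_finSuccSum_mem]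
    exact ⟨hσ, extendEquiv_none _ _ rfl⟩
  · rw [Finset.mem_filter] at hτ
    obtain ⟨σ, rfl⟩ := exists_extendEquiv_eq (finSuccSum q a) τ rfl hτ.2
    exact ⟨σ, extendEquiv_finSuccSum_mem.1 hτ.1, rfl⟩

theorem sum_unshuffles_inr_zero {q a m : ℕ} (G : (Fin q ⊕ Fin (a + 1) ≃ Fin (m + 1)) → M) :
    ∑ τ ∈ unshuffles q (a + 1) (m + 1) with τ (Sum.inr 0) = 0, G τ =
      ∑ σ ∈ unshuffles q a m, G (extendEquiv (sumFinSucc q a) σ) := by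
  symm
  refine Finset.sum_bij (fun σ _ => extendEquiv (sumFinSucc q a) σ) (fun σ hσ => ?_)
    (fun σ _ τ _ h => extendEquiv_injective _ h) (fun τ hτ => ?_) (fun _ _ => rfl)
  · rw [Finset.mem_filter, extendEquiv_sumFinSucc_mem]
    exact ⟨hσ, extendEquiv_none _ _ rfl⟩
  · rw [Finset.mem_filter] at hτ
    obtain ⟨σ, rfl⟩ := exists_extendEquiv_eq (sumFinSucc q a) τ rfl hτ.2
    exact ⟨σ, extendEquiv_sumFinSucc_mem.1 hτ.1, rfl⟩

theorem unshuffles_first {q a m : ℕ} {τ : Fin (q + 1) ⊕ Fin (a + 1) ≃ Fin (m + 1)}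
    (hτ : τ ∈ unshuffles (q + 1) (a + 1) (m + 1)) :
    ¬ τ (Sum.inl 0) = 0 ↔ τ (Sum.inr 0) = 0 := by
  rw [mem_unshuffles] at hτ
  constructor
  · intro h
    obtain ⟨x | y, hx⟩ := τ.surjective 0
    · have := hτ.1.monotone (Fin.zero_le x)
      exact absurd (Fin.le_zero_iff.1 (hx ▸ this)) h
    · have := hτ.2.monotone (Fin.zero_le y)
      exact Fin.le_zero_iff.1 (hx ▸ this)
  · intro h h'
    simpa using τ.injective (h.trans h'.symm)

/-- Both blocks are increasing, so the smallest index is the first element of exactly one of them;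
deleting it leaves a smaller unshuffle. This mirrors the two terms of the recursion of `□`. -/
theorem sum_unshuffles_succ {q a m : ℕ} (G : (Fin (q + 1) ⊕ Fin (a + 1) ≃ Fin (m + 1)) → M) :
    ∑ τ ∈ unshuffles (q + 1) (a + 1) (m + 1), G τ =
      ∑ σ ∈ unshuffles q (a + 1) m, G (extendEquiv (finSuccSum q (a + 1)) σ) +
      ∑ σ ∈ unshuffles (q + 1) a m, G (extendEquiv (sumFinSucc (q + 1) a) σ) := by
  rw [← sum_unshuffles_inl_zero, ← sum_unshuffles_inr_zero,
    ← Finset.sum_filter_add_sum_filter_not _ (fun τ => τ (Sum.inl 0) = 0)]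
  congr 1
  exact Finset.sum_congr (Finset.filter_congr fun τ hτ => unshuffles_first hτ) fun _ _ => rfl

theorem sum_unshuffles_succ_zero {q m : ℕ} (G : (Fin (q + 1) ⊕ Fin 0 ≃ Fin (m + 1)) → M) :
    ∑ τ ∈ unshuffles (q + 1) 0 (m + 1), G τ =
      ∑ σ ∈ unshuffles q 0 m, G (extendEquiv (finSuccSum q 0) σ) := by
  rw [← sum_unshuffles_inl_zero, Finset.filter_true_of_mem]
  intro τ hτ
  obtain ⟨x | y, hx⟩ := τ.surjective 0
  · have := (mem_unshuffles.1 hτ).1.monotone (Fin.zero_le x)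
    exact Fin.le_zero_iff.1 (hx ▸ this)
  · exact y.elim0

theorem unshuffles_zero (a : ℕ) : unshuffles 0 a a = {Equiv.emptySum (Fin 0) (Fin a)} := by
  ext σ
  rw [mem_unshuffles, Finset.mem_singleton]
  constructor
  · intro h
    -- The left block is empty, so this strictly increasing map is onto. Strictly increasing maps of
    -- `Fin a` with the same range agree.
    have : (fun y => σ (Sum.inr y)) = id := by
      refine (h.2.range_inj strictMono_id).1 ?_
      rw [Set.range_id, Set.range_eq_univ]
      intro k
      obtain ⟨x | y, hx⟩ := σ.surjective k
      · exact x.elim0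
      · exact ⟨y, hx⟩
    ext (x | y)
    · exact x.elim0
    · exact congrArg Fin.val (congrFun this y)
  · rintro rfl
    exact ⟨fun x => x.elim0, fun x y h => h⟩

variable {K : Type*} [Field K] {n : ℕ}

theorem shuffleSign_finSuccSum {q a m : ℕ} (σ : Fin q ⊕ Fin a ≃ Fin m) :
    shuffleSign K (fun x => extendEquiv (finSuccSum q a) σ (Sum.inl x))
      (fun y => extendEquiv (finSuccSum q a) σ (Sum.inr y)) =
    shuffleSign K (fun x => σ (Sum.inl x)) (fun y => σ (Sum.inr y)) := by
  have h0 : extendEquiv (finSuccSum q a) σ (Sum.inl 0) = 0 := extendEquiv_none _ _ rfl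
  have h1 (x) : extendEquiv (finSuccSum q a) σ (Sum.inl x.succ) = (σ (Sum.inl x)).succ :=
    extendEquiv_some _ _ rfl
  have h2 (y) : extendEquiv (finSuccSum q a) σ (Sum.inr y) = (σ (Sum.inr y)).succ :=
    extendEquiv_some _ _ rfl
  simp [shuffleSign, Fin.prod_univ_succ, h0, h1, h2]

theorem koszulSign_finSuccSum {q a m : ℕ} (d : Fin (m + 1) → Deg n) (σ : Fin q ⊕ Fin a ≃ Fin m) :
    koszulSign K d (fun x => extendEquiv (finSuccSum q a) σ (Sum.inl x))
      (fun y => extendEquiv (finSuccSum q a) σ (Sum.inr y)) =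
    koszulSign K (fun i => d i.succ) (fun x => σ (Sum.inl x)) (fun y => σ (Sum.inr y)) := by
  have h0 : extendEquiv (finSuccSum q a) σ (Sum.inl 0) = 0 := extendEquiv_none _ _ rfl
  have h1 (x) : extendEquiv (finSuccSum q a) σ (Sum.inl x.succ) = (σ (Sum.inl x)).succ :=
    extendEquiv_some _ _ rfl
  have h2 (y) : extendEquiv (finSuccSum q a) σ (Sum.inr y) = (σ (Sum.inr y)).succ :=
    extendEquiv_some _ _ rfl
  simp [koszulSign, Fin.prod_univ_succ, h0, h1, h2]

/-- The new smallest index of the right block forms an inversion with each of the `q` indices of the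
left block. The Koszul sign below gains the corresponding pairing factors. -/
theorem shuffleSign_sumFinSucc {q a m : ℕ} (σ : Fin q ⊕ Fin a ≃ Fin m) :
    shuffleSign K (fun x => extendEquiv (sumFinSucc q a) σ (Sum.inl x))
      (fun y => extendEquiv (sumFinSucc q a) σ (Sum.inr y)) =
    sgn K q * shuffleSign K (fun x => σ (Sum.inl x)) (fun y => σ (Sum.inr y)) := by
  have h0 : extendEquiv (sumFinSucc q a) σ (Sum.inr 0) = 0 := extendEquiv_none _ _ rfl
  have h1 (x) : extendEquiv (sumFinSucc q a) σ (Sum.inr x.succ) = (σ (Sum.inr x)).succ :=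
    extendEquiv_some _ _ rfl
  have h2 (y) : extendEquiv (sumFinSucc q a) σ (Sum.inl y) = (σ (Sum.inl y)).succ :=
    extendEquiv_some _ _ rfl
  simp [shuffleSign, Fin.prod_univ_succ, h0, h1, h2, Finset.prod_neg, sgn]

theorem koszulSign_sumFinSucc {q a m : ℕ} (d : Fin (m + 1) → Deg n) (σ : Fin q ⊕ Fin a ≃ Fin m) :
    koszulSign K d (fun x => extendEquiv (sumFinSucc q a) σ (Sum.inl x))
      (fun y => extendEquiv (sumFinSucc q a) σ (Sum.inr y)) =
    sgn K (pair (∑ x, d (σ (Sum.inl x)).succ) (d 0)) *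
      koszulSign K (fun i => d i.succ) (fun x => σ (Sum.inl x)) (fun y => σ (Sum.inr y)) := by
  have h0 : extendEquiv (sumFinSucc q a) σ (Sum.inr 0) = 0 := extendEquiv_none _ _ rfl
  have h1 (x) : extendEquiv (sumFinSucc q a) σ (Sum.inr x.succ) = (σ (Sum.inr x)).succ :=
    extendEquiv_some _ _ rfl
  have h2 (y) : extendEquiv (sumFinSucc q a) σ (Sum.inl y) = (σ (Sum.inl y)).succ :=
    extendEquiv_some _ _ rfl
  simp [koszulSign, Fin.prod_univ_succ, h0, h1, h2, Finset.prod_mul_distrib, pair_sum_left, sgn_sum]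

end Unshuffles

/-! ### The square product as a sum over unshuffles -/

section Graded

variable {K V : Type*} [Field K] [AddCommGroup V] [Module K V] {n : ℕ}
variable {𝒱 : Deg n → Submodule K V}

theorem unshuffleSum_apply {m a q : ℕ} (d : Fin m → Deg n) (A : Cochain K V (a + 1))
    (B : Cochain K V q) (v : Fin m → V) :
    unshuffleSum d A B v = ∑ σ ∈ unshuffles q a m,
      (shuffleSign K (fun x => σ (Sum.inl x)) (fun y => σ (Sum.inr y)) *
        koszulSign K d (fun x => σ (Sum.inl x)) (fun y => σ (Sum.inr y))) •
      A (Fin.cons (B fun x => v (σ (Sum.inl x))) fun y => v (σ (Sum.inr y))) := by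
  simp only [unshuffleSum, sum_apply, smul_apply]
  rfl

theorem cons_comp_finSuccSum_inl {X : Type*} {q a m : ℕ} (σ : Fin q ⊕ Fin a ≃ Fin m) (x : X)
    (v : Fin m → X) :
    (fun k => (Fin.cons x v : Fin (m + 1) → X) (extendEquiv (finSuccSum q a) σ (Sum.inl k))) =
      Fin.cons x fun k => v (σ (Sum.inl k)) := by
  funext k
  refine Fin.cases ?_ (fun k => ?_) k
  · rw [extendEquiv_none _ _ rfl]; rfl
  · rw [extendEquiv_some _ (c := Sum.inl k) _ rfl]; rfl

theorem cons_comp_finSuccSum_inr {X : Type*} {q a m : ℕ} (σ : Fin q ⊕ Fin a ≃ Fin m) (x : X)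
    (v : Fin m → X) :
    (fun k => (Fin.cons x v : Fin (m + 1) → X) (extendEquiv (finSuccSum q a) σ (Sum.inr k))) =
      fun k => v (σ (Sum.inr k)) := by
  funext k
  rw [extendEquiv_some _ (c := Sum.inr k) _ rfl]; rfl

theorem cons_comp_sumFinSucc_inr {X : Type*} {q a m : ℕ} (σ : Fin q ⊕ Fin a ≃ Fin m) (x : X)
    (v : Fin m → X) :
    (fun k => (Fin.cons x v : Fin (m + 1) → X) (extendEquiv (sumFinSucc q a) σ (Sum.inr k))) =
      Fin.cons x fun k => v (σ (Sum.inr k)) := by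
  funext k
  refine Fin.cases ?_ (fun k => ?_) k
  · rw [extendEquiv_none _ _ rfl]; rfl
  · rw [extendEquiv_some _ (c := Sum.inr k) _ rfl]; rfl

theorem cons_comp_sumFinSucc_inl {X : Type*} {q a m : ℕ} (σ : Fin q ⊕ Fin a ≃ Fin m) (x : X)
    (v : Fin m → X) :
    (fun k => (Fin.cons x v : Fin (m + 1) → X) (extendEquiv (sumFinSucc q a) σ (Sum.inl k))) =
      fun k => v (σ (Sum.inl k)) := by
  funext k
  rw [extendEquiv_some _ (c := Sum.inl k) _ rfl]; rfl

theorem IsAlphaSkew.apply_cons_cons {p : ℕ} {α : Deg n} {A : Cochain K V (p + 2)}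
    (hA : IsAlphaSkew 𝒱 α A) {γ δ : Deg n} {u v : V} (hu : u ∈ 𝒱 γ) (hv : v ∈ 𝒱 δ)
    {d : Fin p → Deg n} {w : Fin p → V} (hw : ∀ i, w i ∈ 𝒱 (d i)) :
    A (Fin.cons v (Fin.cons u w : Fin (p + 1) → V)) =
      -(sgn K (pair (γ + α) (δ + α)) • A (Fin.cons u (Fin.cons v w : Fin (p + 1) → V))) := by
  have := hA (Fin.cons γ (Fin.cons δ d : Fin (p + 1) → Deg n))
    (Fin.cons u (Fin.cons v w : Fin (p + 1) → V)) (Fin.cases hu (Fin.cases hv hw)) 0 1 rfl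
  rwa [cons_cons_comp_swap] at this

/-- The part of `∑ ± A(B(v_I), v_J)` with `1 ∈ I`. -/
theorem sum_extendEquiv_finSuccSum {m a q : ℕ} (d : Fin (m + 1) → Deg n) (A : Cochain K V (a + 1))
    (B : Cochain K V (q + 1)) (v₀ : V) (v : Fin m → V) :
    ∑ σ ∈ unshuffles q a m,
      (shuffleSign K (fun x => extendEquiv (finSuccSum q a) σ (Sum.inl x))
          (fun y => extendEquiv (finSuccSum q a) σ (Sum.inr y)) *
        koszulSign K d (fun x => extendEquiv (finSuccSum q a) σ (Sum.inl x))
          (fun y => extendEquiv (finSuccSum q a) σ (Sum.inr y))) •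
      A (Fin.cons (B fun x => (Fin.cons v₀ v : Fin (m + 1) → V)
          (extendEquiv (finSuccSum q a) σ (Sum.inl x)))
        fun y => (Fin.cons v₀ v : Fin (m + 1) → V) (extendEquiv (finSuccSum q a) σ (Sum.inr y))) =
    unshuffleSum (fun i => d i.succ) A (B.curryLeft v₀) v := by
  rw [unshuffleSum_apply]
  refine Finset.sum_congr rfl fun σ _ => ?_
  rw [shuffleSign_finSuccSum, koszulSign_finSuccSum, cons_comp_finSuccSum_inl,
    cons_comp_finSuccSum_inr]
  rfl

/-- The part of `∑ ± A(B(v_I), v_J)` with `1 ∈ J`. -/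
theorem sum_extendEquiv_sumFinSucc {m a q : ℕ} {α : Deg n} {wB : Deg n} (d : Fin (m + 1) → Deg n)
    {A : Cochain K V (a + 2)} {B : Cochain K V q} (hA : IsAlphaSkew 𝒱 α A)
    (hB : HasWeight 𝒱 wB B) (v₀ : V) (v : Fin m → V) (hv₀ : v₀ ∈ 𝒱 (d 0))
    (hv : ∀ i, v i ∈ 𝒱 (d i.succ)) :
    ∑ σ ∈ unshuffles q a m,
      (shuffleSign K (fun x => extendEquiv (sumFinSucc q a) σ (Sum.inl x))
          (fun y => extendEquiv (sumFinSucc q a) σ (Sum.inr y)) *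
        koszulSign K (fun i => d i - α) (fun x => extendEquiv (sumFinSucc q a) σ (Sum.inl x))
          (fun y => extendEquiv (sumFinSucc q a) σ (Sum.inr y))) •
      A (Fin.cons (B fun x => (Fin.cons v₀ v : Fin (m + 1) → V)
          (extendEquiv (sumFinSucc q a) σ (Sum.inl x)))
        fun y => (Fin.cons v₀ v : Fin (m + 1) → V) (extendEquiv (sumFinSucc q a) σ (Sum.inr y))) =
    sgn K (q + 1 + pair (biDeg α wB q) (d 0 - α)) •
      unshuffleSum (fun i => d i.succ - α) (A.curryLeft v₀) B v := by
  rw [unshuffleSum_apply, Finset.smul_sum]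
  refine Finset.sum_congr rfl fun σ _ => ?_
  rw [shuffleSign_sumFinSucc, koszulSign_sumFinSucc, cons_comp_sumFinSucc_inl,
    cons_comp_sumFinSucc_inr, hA.apply_cons_cons hv₀
      (hB (fun x => d (σ (Sum.inl x)).succ) _ fun x => hv (σ (Sum.inl x)))
      (fun y => hv (σ (Sum.inr y))), MultilinearMap.curryLeft_apply]
  have e : ∑ x, (d (σ (Sum.inl x)).succ - α) = ∑ x, d (σ (Sum.inl x)).succ - (q : ℤ) • α := by
    simp [Finset.sum_sub_distrib]
  rw [e, smul_smul, ← neg_smul, smul_smul]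
  congr 1
  generalize shuffleSign K _ _ = s1
  generalize koszulSign K _ _ _ = s2
  generalize ∑ x, d (σ (Sum.inl x)).succ = D
  -- The factors come from the signature, the Koszul sign, and the exchange of `v₀` with `B(v_I)`,
  -- of degree `wB + D`. The dependence on `D` cancels because `d 0 + α` and `d 0 - α` agree modulo
  -- 2, so the sign is the same for all `σ`.
  have key : sgn K q * sgn K (pair (D - (q : ℤ) • α) (d 0 - α)) *
      sgn K (pair (d 0 + α) (wB + D + α) + 1) =
      sgn K (q + 1 + pair (biDeg α wB q) (d 0 - α)) := by
    (
      (try simp only [one_mul, mul_one, neg_mul, mul_neg, ← sgn_add, neg_sgn, neg_neg,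
        zero_add, add_zero, zero_sub]) <;>
      refine sgn_eq_of_even ?_ <;> rw [Int.even_iff] <;>
      (try simp only [biDeg, pair_add_left, pair_add_right, pair_sub_left, pair_sub_right,
        pair_smul_left, pair_smul_right, Nat.cast_add, Nat.cast_one, Nat.cast_zero,
        Nat.cast_ofNat]) <;>
      (try simp only [pair_comm]) <;> ring_nf <;> omega)
  rw [neg_sgn, ← key]
  ring

theorem square_apply_zero_right [DirectSum.Decomposition 𝒱] {α : Deg n} {m : ℕ}
    (h : m + 1 + 0 = m + 1) (wA wB : Deg n) (A : Cochain K V (m + 1)) (B : Cochain K V 0)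
    (d : Fin m → Deg n) (v : Fin m → V) :
    square 𝒱 α m (m + 1) 0 h wA wB A B v =
      sgn K (1 + (((m + 1 : ℕ) : ℤ) - 1) * (((0 : ℕ) : ℤ) - 1)) • unshuffleSum d A B v := by
  rw [square_zero_right, unshuffleSum_apply, unshuffles_zero, Finset.sum_singleton]
  simp only [shuffleSign, koszulSign, Finset.univ_eq_empty, Finset.prod_empty, mul_one, one_smul,
    smul_apply, MultilinearMap.curryLeft_apply]
  congr 1
  · (
    (try simp only [one_mul, mul_one, neg_mul, mul_neg, ← sgn_add, neg_sgn, neg_neg,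
      zero_add, add_zero, zero_sub]) <;>
    refine sgn_eq_of_even ?_ <;> rw [Int.even_iff] <;>
    (try simp only [biDeg, pair_add_left, pair_add_right, pair_sub_left, pair_sub_right,
      pair_smul_left, pair_smul_right, Nat.cast_add, Nat.cast_one, Nat.cast_zero,
      Nat.cast_ofNat]) <;>
    (try simp only [pair_comm]) <;> ring_nf <;> omega)
  · congr 2
    exact congrArg B (Subsingleton.elim _ _)

/-- In the recursion of `□`, the term `A □ B(v₀)` is the part of the sum with `1 ∈ I`, and `A(v₀) □
B` is the part with `1 ∈ J`. -/
theorem square_apply [DirectSum.Decomposition 𝒱] {α : Deg n} {m p q : ℕ} (h : p + q = m + 1)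
    {wA wB : Deg n} {A : Cochain K V p} {B : Cochain K V q} (hA : IsAlphaSkew 𝒱 α A)
    (hB : HasWeight 𝒱 wB B) (d : Fin m → Deg n) (v : Fin m → V) (hv : ∀ i, v i ∈ 𝒱 (d i)) :
    square 𝒱 α m p q h wA wB A B v =
      sgn K (1 + ((p : ℤ) - 1) * ((q : ℤ) - 1)) • unshuffleSum (fun i => d i - α) A B v := by
  induction m generalizing p q wA wB with
  | zero =>
    rcases p with _ | a
    · rw [square_zero_left]
      simp [unshuffleSum]
    · obtain rfl : a = 0 := by omega
      obtain rfl : q = 0 := by omega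
      exact square_apply_zero_right _ _ _ _ _ _ _
  | succ m ih =>
    rcases p with _ | a
    · rw [square_zero_left]
      simp [unshuffleSum]
    rcases q with _ | b
    · obtain rfl : a = m + 1 := by omega
      exact square_apply_zero_right _ _ _ _ _ _ _
    obtain ⟨v₀, v, rfl⟩ : ∃ x w, v = Fin.cons x w :=
      ⟨v 0, Fin.tail v, (Fin.cons_self_tail v).symm⟩
    have hv₀ : v₀ ∈ 𝒱 (d 0) := hv 0
    have hv' : ∀ i, v i ∈ 𝒱 (d i.succ) := fun i => hv i.succ
    change (square 𝒱 α (m + 1) (a + 1) (b + 1) h wA wB A B).curryLeft v₀ v = _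
    rw [square_curryLeft _ _ _ _ _ _ _ _ hv₀, add_apply, smul_apply, smul_apply,
      ih _ hA (hB.curryLeft hv₀) (fun i => d i.succ) v hv', unshuffleSum_apply _ A B]
    -- For unary `A` the block `J` is empty: the first index always lies in `I`, in agreement with
    -- `A(v₀) □ B = 0`.
    rcases a with _ | a
    · rw [square_zero_left, sum_unshuffles_succ_zero, sum_extendEquiv_finSuccSum]
      simp only [zero_apply, smul_zero, add_zero, smul_smul]
      congr 1
      (
        (try simp only [one_mul, mul_one, neg_mul, mul_neg, ← sgn_add, neg_sgn, neg_neg,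
          zero_add, add_zero, zero_sub]) <;>
        refine sgn_eq_of_even ?_ <;> rw [Int.even_iff] <;>
        (try simp only [biDeg, pair_add_left, pair_add_right, pair_sub_left, pair_sub_right,
          pair_smul_left, pair_smul_right, Nat.cast_add, Nat.cast_one, Nat.cast_zero,
          Nat.cast_ofNat]) <;>
        (try simp only [pair_comm]) <;> ring_nf <;> omega)
    · rw [ih _ (hA.curryLeft hv₀) hB (fun i => d i.succ) v hv', sum_unshuffles_succ,
        sum_extendEquiv_finSuccSum, sum_extendEquiv_sumFinSucc d hA hB v₀ v hv₀ hv']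
      match_scalars <;> (
        (try simp only [one_mul, mul_one, neg_mul, mul_neg, ← sgn_add, neg_sgn, neg_neg,
          zero_add, add_zero, zero_sub]) <;>
        refine sgn_eq_of_even ?_ <;> rw [Int.even_iff] <;>
        (try simp only [biDeg, pair_add_left, pair_add_right, pair_sub_left, pair_sub_right,
          pair_smul_left, pair_smul_right, Nat.cast_add, Nat.cast_one, Nat.cast_zero,
          Nat.cast_ofNat]) <;>
        (try simp only [pair_comm]) <;> ring_nf <;> omega)

/-! ### The Nijenhuis–Richardson bracket -/

theorem nrInsert_apply [DirectSum.Decomposition 𝒱] {m p q : ℕ} (wA wB : Deg n)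
    (A : Cochain K V p) (B : Cochain K V q) {d : Fin m → Deg n} {v : Fin m → V}
    (hv : ∀ i, v i ∈ 𝒱 (d i)) :
    nrInsert 𝒱 m wA wB A B v = sgn K (pair wA wB) • unshuffleSum d A B v := by
  rw [nrInsert, smul_apply, homExt_apply 𝒱 _ hv]

theorem gmBracket_eq_nrPullback [DirectSum.Decomposition 𝒱] {α : Deg n} {m p q : ℕ}
    (h : p + q = m + 1) {wA wB : Deg n} {A : Cochain K V p} {B : Cochain K V q}
    (hA : HasWeight 𝒱 wA A) (hB : HasWeight 𝒱 wB B)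
    (hA' : IsAlphaSkew 𝒱 α A) (hB' : IsAlphaSkew 𝒱 α B) :
    gmBracket 𝒱 α m p q h wA wB A B = nrPullback 𝒱 α m wA wB A B := by
  refine cochain_ext (𝒱 := 𝒱) fun d v hv => ?_
  -- The degrees `d i - α` of the explicit formula for `□` are the degrees of the arguments in the
  -- shifted space.
  have hv' : ∀ i, v i ∈ desuspend 𝒱 α (d i - α) := fun i => by
    rw [desuspend, sub_add_cancel]; exact hv i
  rw [gmBracket_eq_square, nrPullback, nrBracket, sub_apply, sub_apply, smul_apply, smul_apply,
    nrInsert_apply _ _ _ _ hv', nrInsert_apply _ _ _ _ hv', square_apply _ hA' hB d v hv,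
    square_apply _ hB' hA d v hv]
  match_scalars <;> (
    (try simp only [one_mul, mul_one, neg_mul, mul_neg, ← sgn_add, neg_sgn, neg_neg,
      zero_add, add_zero, zero_sub]) <;>
    refine sgn_eq_of_even ?_ <;> rw [Int.even_iff] <;>
    (try simp only [biDeg, pair_add_left, pair_add_right, pair_sub_left, pair_sub_right,
      pair_smul_left, pair_smul_right, Nat.cast_add, Nat.cast_one, Nat.cast_zero,
      Nat.cast_ofNat]) <;>
    (try simp only [pair_comm]) <;> ring_nf <;> omega)

theorem HasWeight.desuspend {p : ℕ} {w : Deg n} {A : Cochain K V p} (hA : HasWeight 𝒱 w A)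
    (α : Deg n) : HasWeight (desuspend 𝒱 α) (biDeg α w p) A := by
  intro d v hv
  have := hA _ v hv
  rw [GradedBracket.desuspend, biDeg]
  convert this using 2
  rw [Finset.sum_add_distrib, Finset.sum_const, Finset.card_univ, Fintype.card_fin]
  module

theorem IsAlphaSkew.desuspend {p : ℕ} {α : Deg n} {A : Cochain K V p} (hA : IsAlphaSkew 𝒱 α A) :
    IsAlphaSkew (desuspend 𝒱 α) 0 A := by
  intro d v hv i j hij
  rw [hA _ v hv i j hij]
  congr 2
  -- A vector of shifted degree `d i` has degree `d i + α` in `𝒱`, so the exponent involves `d i + α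
  -- + α`, and the two copies of `α` disappear modulo 2.
  rw [add_zero, add_zero]
  (
    (try simp only [one_mul, mul_one, neg_mul, mul_neg, ← sgn_add, neg_sgn, neg_neg,
      zero_add, add_zero, zero_sub]) <;>
    refine sgn_eq_of_even ?_ <;> rw [Int.even_iff] <;>
    (try simp only [biDeg, pair_add_left, pair_add_right, pair_sub_left, pair_sub_right,
      pair_smul_left, pair_smul_right, Nat.cast_add, Nat.cast_one, Nat.cast_zero,
      Nat.cast_ofNat]) <;>
    (try simp only [pair_comm]) <;> ring_nf <;> omega)

end Graded

/-! ### Graded symmetric maps -/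

section Symmetry

variable {K V : Type*} [Field K] [AddCommGroup V] [Module K V] {n : ℕ}
variable {𝒱 : Deg n → Submodule K V}

/-- Graded symmetry, with respect to exchanges of two neighbouring arguments. -/
def IsGradedSymm (𝒱 : Deg n → Submodule K V) {p : ℕ} (f : Cochain K V p) : Prop :=
  ∀ (d : Fin p → Deg n) (v : Fin p → V), (∀ i, v i ∈ 𝒱 (d i)) →
    ∀ i j : Fin p, (i : ℕ) + 1 = j → f (v ∘ Equiv.swap i j) = sgn K (pair (d i) (d j)) • f v

theorem insertNth_succ_eq_comp_swap {X : Type*} {a : ℕ} (i : Fin a) (x : X) (y : Fin a → X) :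
    (i.succ.insertNth x y : Fin (a + 1) → X) =
      (i.castSucc.insertNth x y : Fin (a + 1) → X) ∘ Equiv.swap i.castSucc i.succ := by
  rw [Fin.insertNth_eq_iff]
  constructor
  · simp
  · funext j
    rw [Fin.removeNth, Function.comp_apply]
    by_cases hj : j = i
    · subst hj
      rw [Fin.succAbove_succ_self, Equiv.swap_apply_left]
      conv_rhs => rw [← Fin.succAbove_castSucc_self j]
      rw [Fin.insertNth_apply_succAbove]
    · have h : i.succ.succAbove j = i.castSucc.succAbove j := by
        rcases lt_or_gt_of_ne hj with h | h
        · rw [Fin.succAbove_of_castSucc_lt _ _ (Fin.castSucc_lt_succ_iff.2 h.le),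
            Fin.succAbove_of_castSucc_lt _ _ (Fin.castSucc_lt_castSucc_iff.2 h)]
        · rw [Fin.succAbove_of_le_castSucc _ _ (Fin.succ_le_castSucc_iff.2 h),
            Fin.succAbove_of_le_castSucc _ _ (Fin.castSucc_le_castSucc_iff.2 h.le)]
      rw [Equiv.swap_apply_of_ne_of_ne (h ▸ Fin.succAbove_ne _ _) (Fin.succAbove_ne _ _), h,
        Fin.insertNth_apply_succAbove]

/-- Each shift of `x` by one place is a neighbouring swap, so moving it to the front costs one
pairing with every argument it passes. This is where symmetry of the outer map enters in the
composition of coderivations. -/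
theorem IsGradedSymm.apply_insertNth {a : ℕ} {f : Cochain K V (a + 1)} (hf : IsGradedSymm 𝒱 f)
    {δ : Deg n} {x : V} (hx : x ∈ 𝒱 δ) {d : Fin a → Deg n} {y : Fin a → V}
    (hy : ∀ j, y j ∈ 𝒱 (d j)) (i : Fin (a + 1)) :
    f (i.insertNth x y) =
      (∏ j : Fin a, if (j : ℕ) < i then sgn K (pair δ (d j)) else 1) • f (Fin.cons x y) := by
  induction i using Fin.induction with
  | zero => simp [Fin.insertNth_zero']
  | succ i ih =>
    have hm : ∀ k, (i.castSucc.insertNth x y : Fin (a + 1) → V) k ∈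
        𝒱 ((i.castSucc.insertNth δ d : Fin (a + 1) → Deg n) k) := by
      intro k
      refine Fin.succAboveCases i.castSucc ?_ (fun j => ?_) k
      · simpa using hx
      · simpa using hy j
    rw [insertNth_succ_eq_comp_swap, hf _ _ hm _ _ (by simp), ih, smul_smul,
      Fin.insertNth_apply_same, ← Fin.succAbove_castSucc_self i, Fin.insertNth_apply_succAbove]
    congr 1
    have : ∀ j : Fin a, (if (j : ℕ) < (i.castSucc.succAbove i : Fin (a + 1)) then
          sgn K (pair δ (d j)) else 1) =
        (if j = i then sgn K (pair δ (d j)) else 1) *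
          (if (j : ℕ) < (i.castSucc : Fin (a + 1)) then sgn K (pair δ (d j)) else 1) := by
      intro j
      rw [Fin.succAbove_castSucc_self]
      rcases lt_trichotomy j i with h | h | h
      · have h' : (j : ℕ) < i := h
        simp [h.ne, h', h'.le, Nat.lt_succ_of_lt]
      · subst h; simp
      · have h' : (i : ℕ) < j := h
        simp [h.ne', h'.not_gt, Nat.succ_le_of_lt h', h.not_ge]
    rw [Finset.prod_congr rfl fun j _ => this j, Finset.prod_mul_distrib]
    simp

end Symmetry

/-! ### From triples of unshuffles to pairs -/

section CoderUnshuffles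

/-- For increasing `g`, the indices with value below `t` form an initial segment, whose length is
`i`. It recovers `I` from `I ∪ (K \ k₁)`: `I` is the part that precedes `t = k₁`. -/
theorem existsUnique_cut {a m : ℕ} {g : Fin a → Fin m} (hg : StrictMono g) (t : Fin m) :
    ∃ i ≤ a, (∀ z : Fin a, (z : ℕ) < i ↔ g z < t) ∧
      ∀ j ≤ a, (∀ z : Fin a, (z : ℕ) < j ↔ g z < t) → j = i := by
  classical
  have hex : ∃ i, ∀ z : Fin a, i ≤ (z : ℕ) → ¬ g z < t := ⟨a, fun z hz => absurd z.2 (by omega)⟩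
  have hle : Nat.find hex ≤ a := Nat.find_min' hex fun z hz => absurd z.2 (by omega)
  have hcut : ∀ z : Fin a, (z : ℕ) < Nat.find hex ↔ g z < t := by
    intro z
    constructor
    · intro hz
      have := Nat.find_min hex hz
      push Not at this
      obtain ⟨z', h1, h2⟩ := this
      exact (hg.monotone (show z ≤ z' from h1)).trans_lt h2
    · intro hz
      by_contra h
      exact Nat.find_spec hex z (by omega) hz
  refine ⟨_, hle, hcut, fun j hj hcut' => ?_⟩
  rcases lt_trichotomy j (Nat.find hex) with h | h | h
  · have := (hcut ⟨j, by omega⟩).1 h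
    have := (hcut' ⟨j, by omega⟩).2 this
    simp at this
  · exact h
  · have := (hcut' ⟨Nat.find hex, by omega⟩).1 h
    exact absurd ((hcut ⟨Nat.find hex, by omega⟩).2 this) (lt_irrefl _)

/-- `(I; J ∪ k₁; K \ k₁) ↦ (J ∪ k₁; I ∪ K \ k₁)`. -/
def blockEquiv {i r a : ℕ} (b : ℕ) (h : i + r = a) :
    Fin i ⊕ (Fin (b + 1) ⊕ Fin r) ≃ Fin (b + 1) ⊕ Fin a :=
  (Equiv.sumAssoc _ _ _).symm.trans
    (((Equiv.sumComm _ _).sumCongr (Equiv.refl _)).trans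
      ((Equiv.sumAssoc _ _ _).trans
        ((Equiv.refl _).sumCongr (finSumFinEquiv.trans (finCongr h)))))

@[simp] theorem blockEquiv_inl {i r a b : ℕ} (h : i + r = a) (x : Fin i) :
    blockEquiv b h (Sum.inl x) = Sum.inr (Fin.cast h (Fin.castAdd r x)) := rfl

@[simp] theorem blockEquiv_inr_inl {i r a b : ℕ} (h : i + r = a) (y : Fin (b + 1)) :
    blockEquiv b h (Sum.inr (Sum.inl y)) = Sum.inl y := rfl

@[simp] theorem blockEquiv_inr_inr {i r a b : ℕ} (h : i + r = a) (z : Fin r) :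
    blockEquiv b h (Sum.inr (Sum.inr z)) = Sum.inr (Fin.cast h (Fin.natAdd i z)) := rfl

theorem blockEquiv_trans_mem {i r a b m : ℕ} (h : i + r = a) (σ : Fin (b + 1) ⊕ Fin a ≃ Fin m) :
    (blockEquiv b h).trans σ ∈ coderUnshuffles i b r m ↔ σ ∈ unshuffles (b + 1) a m ∧
      ∀ z : Fin a, (z : ℕ) < i ↔ σ (Sum.inr z) < σ (Sum.inl (Fin.last b)) := by
  subst h
  simp only [coderUnshuffles, Finset.mem_filter, Finset.mem_univ, true_and, mem_unshuffles,
    Equiv.trans_apply, blockEquiv_inl, blockEquiv_inr_inl, blockEquiv_inr_inr, Fin.cast_eq_self]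
  constructor
  · rintro ⟨h1, h2, h3, h4, h5⟩
    refine ⟨⟨h2, fun x y => ?_⟩, fun z => ?_⟩
    · refine Fin.addCases (fun x => ?_) (fun x => ?_) x <;>
        refine Fin.addCases (fun y => ?_) (fun y => ?_) y <;> intro hxy
      · exact h1 (by simp only [Fin.lt_def, Fin.val_castAdd] at hxy ⊢; omega)
      · exact (h4 x).trans (h5 y)
      · simp only [Fin.lt_def, Fin.val_castAdd, Fin.val_natAdd] at hxy; omega
      · exact h3 (by simp only [Fin.lt_def, Fin.val_natAdd] at hxy ⊢; omega)
    · refine Fin.addCases (fun z => ?_) (fun z => ?_) z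
      · simpa using h4 z
      · simpa using (h5 z).le
  · rintro ⟨⟨h1, h2⟩, h3⟩
    refine ⟨fun x y hxy => h2 (by simpa only [Fin.lt_def, Fin.val_castAdd] using hxy), h1,
      fun x y hxy => h2 (by simpa only [Fin.lt_def, Fin.val_natAdd, Nat.add_lt_add_iff_left]
        using hxy), fun x => (h3 _).1 (by simp),
      fun z => ?_⟩
    refine lt_of_le_of_ne (not_lt.1 fun hlt => ?_) fun he => by simpa using σ.injective he
    have := (h3 _).2 hlt
    simp at this

theorem coderUnshuffles_eq_empty {i r a b m : ℕ} (hm : a + b + 1 = m) (h : i + r ≠ a) :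
    coderUnshuffles i b r m = ∅ := by
  refine Finset.eq_empty_of_forall_notMem fun σ _ => h ?_
  have := Fintype.card_congr σ
  simp only [Fintype.card_sum, Fintype.card_fin] at this
  omega

/-- A sum over triples `(I; J ∪ k₁; K \ k₁)` as a sum over pairs of unshuffles. -/
theorem sum_coderUnshuffles {M : Type*} [AddCommMonoid M] {a b m : ℕ} (hm : a + b + 1 = m)
    (F : ∀ i r, (Fin i ⊕ (Fin (b + 1) ⊕ Fin r) ≃ Fin m) → M)
    (G : (Fin (b + 1) ⊕ Fin a ≃ Fin m) → M)
    (hFG : ∀ i r (h : i + r = a), ∀ σ ∈ unshuffles (b + 1) a m,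
      (∀ z : Fin a, (z : ℕ) < i ↔ σ (Sum.inr z) < σ (Sum.inl (Fin.last b))) →
      F i r ((blockEquiv b h).trans σ) = G σ) :
    ∑ i ∈ Finset.range (m + 1), ∑ r ∈ Finset.range (m + 1), ∑ σ ∈ coderUnshuffles i b r m, F i r σ =
      ∑ σ ∈ unshuffles (b + 1) a m, G σ := by
  classical
  have h1 : ∀ i r, ∑ σ ∈ coderUnshuffles i b r m, F i r σ = ∑ σ ∈ unshuffles (b + 1) a m,
      if i + r = a ∧ ∀ z : Fin a, (z : ℕ) < i ↔ σ (Sum.inr z) < σ (Sum.inl (Fin.last b))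
      then G σ else 0 := by
    intro i r
    by_cases h : i + r = a
    · simp only [h, true_and]
      rw [← Finset.sum_filter]
      symm
      refine Finset.sum_bij (fun σ _ => (blockEquiv b h).trans σ) (fun σ hσ => ?_)
        (fun σ _ τ _ e => ?_) (fun τ hτ => ?_) (fun σ hσ => ?_)
      · exact (blockEquiv_trans_mem h σ).2 (Finset.mem_filter.1 hσ)
      · have := congrArg (fun e => (blockEquiv b h).symm.trans e) e
        simpa [← Equiv.trans_assoc] using this
      · refine ⟨(blockEquiv b h).symm.trans τ, ?_, by simp [← Equiv.trans_assoc]⟩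
        rw [Finset.mem_filter, ← blockEquiv_trans_mem h]
        simpa [← Equiv.trans_assoc] using hτ
      · rw [Finset.mem_filter] at hσ
        exact (hFG i r h σ hσ.1 hσ.2).symm
    · simp [coderUnshuffles_eq_empty hm h, h]
  simp only [h1]
  rw [Finset.sum_congr rfl fun i _ => Finset.sum_comm, Finset.sum_comm]
  refine Finset.sum_congr rfl fun σ hσ => ?_
  -- Each pair of unshuffles comes from exactly one pair of sizes: the last element of the left
  -- block is `k₁`, the cut there gives `|I| = i`, and `r = a - i` is the rest.
  obtain ⟨i, hi, hcut, huniq⟩ := existsUnique_cut (mem_unshuffles.1 hσ).2 (σ (Sum.inl (Fin.last b)))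
  rw [Finset.sum_eq_single_of_mem i (Finset.mem_range.2 (by omega)),
    Finset.sum_eq_single_of_mem (a - i) (Finset.mem_range.2 (by omega)),
    if_pos ⟨by omega, hcut⟩]
  · intro r _ hr
    exact if_neg fun h => hr (by omega)
  · intro j _ hj
    exact Finset.sum_eq_zero fun r _ => if_neg fun h => hj (huniq j (by omega) h.2)

end CoderUnshuffles

/-! ### Corestrictions of coderivations and of their composites -/

section Coderivation

variable {K V : Type*} [Field K] [AddCommGroup V] [Module K V] {n : ℕ}
variable {𝒱 : Deg n → Submodule K V}

theorem tensorInsert_apply {i r b : ℕ} (f : Cochain K V (b + 1))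
    (y : Fin i ⊕ (Fin (b + 1) ⊕ Fin r) → V) :
    tensorInsert i r f y = TensorAlgebra.tprod K V i (fun x => y (Sum.inl x)) *
      (TensorAlgebra.ι K (f fun x => y (Sum.inr (Sum.inl x))) *
        TensorAlgebra.tprod K V r (fun x => y (Sum.inr (Sum.inr x)))) := by
  simp only [tensorInsert, LinearMap.compMultilinearMap_apply, MultilinearMap.domCoprod_apply,
    LinearMap.mul'_apply]

theorem insertNth_append {X : Type*} (i r : ℕ) (x : X) (u : Fin i → X) (w : Fin r → X) :
    (Fin.insertNth (⟨i, by omega⟩ : Fin (i + r + 1)) x (Fin.append u w) : Fin (i + r + 1) → X) =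
      (Fin.append u (Fin.cons x w : Fin (r + 1) → X) : Fin (i + (r + 1)) → X) := by
  rw [Fin.insertNth_eq_iff]
  constructor
  · exact (Fin.append_right u (Fin.cons x w : Fin (r + 1) → X) 0).symm
  · funext j
    rw [Fin.removeNth]
    refine Fin.addCases (fun j => ?_) (fun j => ?_) j
    · rw [Fin.append_left, Fin.succAbove_of_castSucc_lt _ _ (by simp [Fin.lt_def])]
      exact (Fin.append_left u (Fin.cons x w : Fin (r + 1) → X) j).symm
    · rw [Fin.append_right, Fin.succAbove_of_le_castSucc _ _ (by simp [Fin.le_def])]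
      exact (Fin.append_right u (Fin.cons x w : Fin (r + 1) → X) j.succ).symm

theorem tprod_append_cons {i r : ℕ} (x : V) (u : Fin i → V) (w : Fin r → V) :
    TensorAlgebra.tprod K V (i + (r + 1)) (Fin.append u (Fin.cons x w : Fin (r + 1) → V)) =
      TensorAlgebra.tprod K V i u * (TensorAlgebra.ι K x * TensorAlgebra.tprod K V r w) := by
  simp only [TensorAlgebra.tprod_apply]
  rw [List.ofFn_comp' (Fin.append _ _) (TensorAlgebra.ι K), List.ofFn_fin_append, List.map_append,
    List.prod_append, ← List.ofFn_comp', ← List.ofFn_comp', List.ofFn_succ, List.prod_cons]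
  rfl

theorem tensorInsert_blockEquiv {i r a b : ℕ} (h : i + r = a) (f : Cochain K V (b + 1))
    (y : Fin (b + 1) ⊕ Fin a → V) :
    tensorInsert i r f (fun k => y (blockEquiv b h k)) =
      TensorAlgebra.tprod K V (a + 1) (Fin.insertNth ⟨i, by omega⟩ (f fun x => y (Sum.inl x))
        fun z => y (Sum.inr z)) := by
  subst h
  have e : (fun z => y (Sum.inr z)) =
      Fin.append (fun x => y (Sum.inr (Fin.castAdd r x))) fun x => y (Sum.inr (Fin.natAdd i x)) := by
    funext z
    refine Fin.addCases (fun z => ?_) (fun z => ?_) z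
    · rw [Fin.append_left]
    · rw [Fin.append_right]
  rw [e, insertNth_append, tensorInsert_apply]
  exact (tprod_append_cons _ _ _).symm

variable [DirectSum.Decomposition 𝒱]

theorem coderivation_tprod (w : Deg n) {b p : ℕ} (f : Cochain K V (b + 1)) {d : Fin p → Deg n}
    {v : Fin p → V} (hv : ∀ i, v i ∈ 𝒱 (d i)) :
    coderivation 𝒱 w f (TensorAlgebra.tprod K V p v) =
      ∑ i ∈ Finset.range (p + 1), ∑ r ∈ Finset.range (p + 1), ∑ σ ∈ coderUnshuffles i b r p,
        (koszulSign K d (fun x => σ (Sum.inl x)) (fun y => σ (Sum.inr (Sum.inl y))) *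
          sgn K (∑ x : Fin i, pair w (d (σ (Sum.inl x))))) •
        tensorInsert i r f (fun k => v (σ k)) := by
  have h : (TensorAlgebra.equivDirectSum (R := K) (M := V)).toLinearMap
      (TensorAlgebra.tprod K V p v) =
        DirectSum.lof K ℕ (fun n => ⨂[K]^n V) p (PiTensorProduct.tprod K v) :=
    TensorAlgebra.toDirectSum_tensorPower_tprod v
  rw [coderivation, LinearMap.comp_apply, h, DirectSum.toModule_lof, PiTensorProduct.lift.tprod,
    homExt_apply 𝒱 _ hv]
  simp only [sum_apply, smul_apply]
  rfl

theorem unshuffles_zero_right (q : ℕ) : unshuffles q 0 q = {Equiv.sumEmpty (Fin q) (Fin 0)} := by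
  ext σ
  rw [mem_unshuffles, Finset.mem_singleton]
  constructor
  · intro h
    have : (fun y => σ (Sum.inl y)) = id := by
      refine (h.1.range_inj strictMono_id).1 ?_
      rw [Set.range_id, Set.range_eq_univ]
      intro k
      obtain ⟨x | y, hx⟩ := σ.surjective k
      · exact ⟨x, hx⟩
      · exact y.elim0
    ext (x | y)
    · exact congrArg Fin.val (congrFun this x)
    · exact y.elim0
  · rintro rfl
    exact ⟨fun x y h => h, fun x => x.elim0⟩

/-- The corestriction of the coderivation attached to `f` is `f`. -/
theorem ιInv_coderivation_tprod (w : Deg n) {b : ℕ} (f : Cochain K V (b + 1))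
    (v : Fin (b + 1) → V) :
    TensorAlgebra.ιInv (coderivation 𝒱 w f (TensorAlgebra.tprod K V (b + 1) v)) = f v := by
  suffices h : corestriction (b + 1) (coderivation 𝒱 w f) = f from
    congrArg (fun g : Cochain K V (b + 1) => g v) h
  refine cochain_ext (𝒱 := 𝒱) fun d v hv => ?_
  change TensorAlgebra.ιInv (coderivation 𝒱 w f (TensorAlgebra.tprod K V (b + 1) v)) = f v
  rw [coderivation_tprod w f hv]
  simp only [map_sum, map_smul]
  rw [sum_coderUnshuffles (a := 0) (by omega) _ (fun σ => f fun x => v (σ (Sum.inl x))),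
    unshuffles_zero_right, Finset.sum_singleton]
  · rfl
  · intro i r h σ _ _
    -- On words of length `b + 1` the map `f` consumes all letters, so `I` and `K \ k₁` are empty
    -- and no sign occurs.
    obtain rfl : i = 0 := by omega
    obtain rfl : r = 0 := by omega
    rw [tensorInsert_apply]
    simp only [koszulSign, Finset.univ_eq_empty, Finset.prod_empty, Finset.sum_empty, sgn_zero,
      mul_one, one_smul, TensorAlgebra.tprod_apply, List.ofFn_zero, List.prod_nil, one_mul,
      Equiv.trans_apply, blockEquiv_inr_inl]
    exact TensorAlgebra.ι_leftInverse _

theorem prod_fin_castAdd {M : Type*} [CommMonoid M] {i r a : ℕ} (h : i + r = a) (F : Fin a → M) :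
    ∏ x : Fin i, F (Fin.cast h (Fin.castAdd r x)) = ∏ j : Fin a, if (j : ℕ) < i then F j else 1 := by
  subst h
  simp [Fin.prod_univ_add]

/-- The sign of the term `I ⊗ (J ∪ k₁) ⊗ K \ k₁`, moved to `(J ∪ k₁) ⊗ I ⊗ K \ k₁`. -/
theorem koszulSign_blockEquiv {i r a b m : ℕ} (h : i + r = a) (w : Deg n) (d : Fin m → Deg n)
    {σ : Fin (b + 1) ⊕ Fin a ≃ Fin m} (hσ : σ ∈ unshuffles (b + 1) a m)
    (hcut : ∀ z : Fin a, (z : ℕ) < i ↔ σ (Sum.inr z) < σ (Sum.inl (Fin.last b))) :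
    koszulSign K d (fun x => (blockEquiv b h).trans σ (Sum.inl x))
        (fun y => (blockEquiv b h).trans σ (Sum.inr (Sum.inl y))) *
      sgn K (∑ x : Fin i, pair w (d ((blockEquiv b h).trans σ (Sum.inl x)))) *
      (∏ j : Fin a, if (j : ℕ) < i then
        sgn K (pair (w + ∑ y, d (σ (Sum.inl y))) (d (σ (Sum.inr j)))) else 1) =
    koszulSign K d (fun x => σ (Sum.inl x)) (fun y => σ (Sum.inr y)) := by
  change koszulSign K d (fun x => σ (Sum.inr (Fin.cast h (Fin.castAdd r x))))
      (fun y => σ (Sum.inl y)) *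
    sgn K (∑ x : Fin i, pair w (d (σ (Sum.inr (Fin.cast h (Fin.castAdd r x)))))) * _ = _
  simp only [koszulSign, sgn_sum]
  rw [prod_fin_castAdd h (fun z => ∏ y, if σ (Sum.inl y) < σ (Sum.inr z) then
      sgn K (pair (d (σ (Sum.inr z))) (d (σ (Sum.inl y)))) else 1),
    prod_fin_castAdd h (fun z => sgn K (pair w (d (σ (Sum.inr z))))),
    ← Finset.prod_mul_distrib, ← Finset.prod_mul_distrib, Finset.prod_comm]
  refine Finset.prod_congr rfl fun z _ => ?_
  -- For `z` in `I`, the sign of `w` passing `V_I` cancels against the move to the front. The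
  -- remaining pairing with the left block turns each inversion of `(I; J ∪ k₁)` into a
  -- non-inversion of the reversed order, and conversely. Elements of `K \ k₁` follow the whole left
  -- block and contribute nothing.
  by_cases hz : (z : ℕ) < i
  · simp only [hz, if_true, pair_add_left, pair_sum_left, sgn_add, sgn_sum]
    rw [mul_assoc, ← mul_assoc (sgn K (pair w _)), sgn_mul_self, one_mul,
      ← Finset.prod_mul_distrib]
    refine Finset.prod_congr rfl fun y _ => ?_
    rw [pair_comm (d (σ (Sum.inr z)))]
    rcases lt_trichotomy (σ (Sum.inl y)) (σ (Sum.inr z)) with hlt | heq | hgt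
    · rw [if_pos hlt, if_neg hlt.not_gt, sgn_mul_self]
    · simpa using σ.injective heq
    · rw [if_neg hgt.not_gt, if_pos hgt, one_mul]
  · simp only [hz, if_false, one_mul]
    symm
    refine Finset.prod_eq_one fun y _ => if_neg fun hlt => hz ((hcut z).2 (hlt.trans_le ?_))
    exact (mem_unshuffles.1 hσ).1.monotone (Fin.le_last y)

/-- The corestriction of the composite of two coderivations, for a graded symmetric `f`. -/
theorem corestriction_coderivation_comp {a b m : ℕ} (hm : a + b + 1 = m) {wf wg : Deg n}
    {f : Cochain K V (a + 1)} {g : Cochain K V (b + 1)} (hf : IsGradedSymm 𝒱 f)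
    (hg : HasWeight 𝒱 wg g) {d : Fin m → Deg n} {v : Fin m → V} (hv : ∀ i, v i ∈ 𝒱 (d i)) :
    corestriction m ((coderivation 𝒱 wf f).comp (coderivation 𝒱 wg g)) v =
      ∑ σ ∈ unshuffles (b + 1) a m,
        koszulSign K d (fun x => σ (Sum.inl x)) (fun y => σ (Sum.inr y)) •
        f (Fin.cons (g fun x => v (σ (Sum.inl x))) fun y => v (σ (Sum.inr y))) := by
  change TensorAlgebra.ιInv (coderivation 𝒱 wf f
    (coderivation 𝒱 wg g (TensorAlgebra.tprod K V m v))) = _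
  rw [coderivation_tprod wg g hv]
  simp only [map_sum, map_smul]
  refine sum_coderUnshuffles hm _ _ fun i r h σ hσ hcut => ?_
  have e := tensorInsert_blockEquiv h g (fun k => v (σ k))
  simp only [Equiv.trans_apply] at e ⊢
  -- After the inner coderivation the word has length `a + 1`, so the corestriction of the outer one
  -- is `f` itself, evaluated with the output of `g` in position `i`.
  rw [e, ιInv_coderivation_tprod, hf.apply_insertNth (hg _ _ fun x => hv (σ (Sum.inl x)))
    (fun y => hv (σ (Sum.inr y))), smul_smul]
  congr 1
  exact koszulSign_blockEquiv h wg d hσ hcut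

end Coderivation

/-! ### Exponents of the iterated suspension as sums over pairs of positions -/

section InversionSums

theorem sum_sub_succ_eq (p : ℕ) :
    ∑ s : Fin p, ((p : ℤ) - ((s : ℤ) + 1)) = ((p * (p - 1) / 2 : ℕ) : ℤ) := by
  rw [← Finset.sum_range_id, Nat.cast_sum, ← Finset.sum_range_reflect,
    ← Fin.sum_univ_eq_sum_range (fun j => ((p - 1 - j : ℕ) : ℤ))]
  refine Finset.sum_congr rfl fun s _ => ?_
  have := s.2
  omega

theorem two_mul_triangle (p : ℕ) : 2 * ((p * (p - 1) / 2 : ℕ) : ℤ) = p * (p - 1) := by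
  have h := Nat.div_mul_cancel (Nat.even_mul_pred_self p).two_dvd
  rcases p with _ | p
  · simp
  · push_cast [Nat.add_sub_cancel] at h ⊢
    have h' : (((p + 1) * p / 2 : ℕ) : ℤ) * 2 = (p + 1) * p := by exact_mod_cast h
    push_cast at h'
    linarith

/-- Reading the coefficient `p - s` as the number of later positions turns the suspension exponent
into a sum over ordered pairs of positions, which can be split along the blocks of an unshuffle. -/
theorem sub_succ_eq_sum {p : ℕ} (s : Fin p) :
    (p : ℤ) - ((s : ℤ) + 1) = ∑ k : Fin p, if s < k then (1 : ℤ) else 0 := by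
  rw [Finset.sum_boole, show (Finset.univ.filter fun k => s < k) = Finset.Ioi s by ext; simp,
    Fin.card_Ioi]
  have := s.2
  omega

/-- Pairs of positions are sorted by whether they lie in one block or in both. Within a block the
unshuffle preserves order; a cross pair counts the value of whichever element comes first. The term
`a * ∑ y` counts every cross pair with its left value, and the sums over inversions correct for
this. -/
theorem sum_sub_succ_mul_unshuffle {q a m : ℕ} {σ : Fin q ⊕ Fin a ≃ Fin m}
    (hσ : σ ∈ unshuffles q a m) (y : Fin m → ℤ) :
    ∑ j : Fin m, ((m : ℤ) - ((j : ℤ) + 1)) * y j +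
        ∑ x, ∑ z, (if σ (Sum.inr z) < σ (Sum.inl x) then y (σ (Sum.inl x)) else 0) =
      ∑ x : Fin q, ((q : ℤ) - ((x : ℤ) + 1)) * y (σ (Sum.inl x)) +
        ∑ z : Fin a, ((a : ℤ) - ((z : ℤ) + 1)) * y (σ (Sum.inr z)) +
        a * ∑ x, y (σ (Sum.inl x)) +
        ∑ x, ∑ z, (if σ (Sum.inr z) < σ (Sum.inl x) then y (σ (Sum.inr z)) else 0) := by
  obtain ⟨h1, h2⟩ := mem_unshuffles.1 hσ
  have e1 (x x' : Fin q) : σ (Sum.inl x) < σ (Sum.inl x') ↔ x < x' := h1.lt_iff_lt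
  have e2 (x x' : Fin a) : σ (Sum.inr x) < σ (Sum.inr x') ↔ x < x' := h2.lt_iff_lt
  have e3 : ∑ x, ∑ z, (if σ (Sum.inr z) < σ (Sum.inl x) then y (σ (Sum.inr z)) else 0) =
      ∑ z, ∑ x, (if σ (Sum.inr z) < σ (Sum.inl x) then y (σ (Sum.inr z)) else 0) :=
    Finset.sum_comm
  have e4 : (a : ℤ) * ∑ x, y (σ (Sum.inl x)) =
      ∑ x, ∑ z, (if σ (Sum.inl x) < σ (Sum.inr z) then y (σ (Sum.inl x)) else 0) +
      ∑ x, ∑ z, (if σ (Sum.inr z) < σ (Sum.inl x) then y (σ (Sum.inl x)) else 0) := by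
    rw [Finset.mul_sum, ← Finset.sum_add_distrib]
    refine Finset.sum_congr rfl fun x _ => ?_
    have hc : (a : ℤ) * y (σ (Sum.inl x)) = ∑ _z : Fin a, y (σ (Sum.inl x)) := by simp
    rw [← Finset.sum_add_distrib, hc]
    refine Finset.sum_congr rfl fun z _ => ?_
    rcases lt_trichotomy (σ (Sum.inl x)) (σ (Sum.inr z)) with hlt | heq | hgt
    · rw [if_pos hlt, if_neg hlt.not_gt, add_zero]
    · simpa using σ.injective heq
    · rw [if_neg hgt.not_gt, if_pos hgt, zero_add]
  have e5 : ∑ j : Fin m, ((m : ℤ) - ((j : ℤ) + 1)) * y j =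
      ∑ x, ∑ x' : Fin q, (if x < x' then y (σ (Sum.inl x)) else 0) +
      ∑ x, ∑ z, (if σ (Sum.inl x) < σ (Sum.inr z) then y (σ (Sum.inl x)) else 0) +
      (∑ z, ∑ x, (if σ (Sum.inr z) < σ (Sum.inl x) then y (σ (Sum.inr z)) else 0) +
      ∑ z, ∑ z' : Fin a, (if z < z' then y (σ (Sum.inr z)) else 0)) := by
    simp only [sub_succ_eq_sum, Finset.sum_mul, ite_mul, one_mul, zero_mul]
    rw [← Equiv.sum_comp σ]
    simp only [← Equiv.sum_comp σ (fun k => ite (_ < k) _ _), Fintype.sum_sum_type, e1, e2,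
      Finset.sum_add_distrib]
    ring
  rw [e5, e4, e3]
  simp only [sub_succ_eq_sum, Finset.sum_mul, ite_mul, one_mul, zero_mul]
  ring

end InversionSums

/-! ### Décalage and the stem bracket -/

section Stem

variable {K V : Type*} [Field K] [AddCommGroup V] [Module K V] {n : ℕ} [NeZero n]
variable {𝒱 : Deg n → Submodule K V}

theorem pair_e₁_self : pair (e₁ : Deg n) e₁ = 1 := by
  simp [pair, e₁, Pi.single_apply]

/-- Since `⟨e₁, e₁⟩ = 1`, shifting both degrees of an inversion by `e₁` produces an extra `-1`,
which cancels the signature. Only the terms linear in `e₁` survive, and the suspension signs absorb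
them. -/
theorem shuffleSign_mul_koszulSign_add_e₁ {i j m : ℕ} (d : Fin m → Deg n) (I : Fin i → Fin m)
    (J : Fin j → Fin m) :
    shuffleSign K I J * koszulSign K (fun k => d k + e₁) I J = koszulSign K d I J *
      sgn K (∑ x, ∑ z, ((if J z < I x then pair e₁ (d (I x)) else 0) +
        (if J z < I x then pair e₁ (d (J z)) else 0))) := by
  simp only [shuffleSign, koszulSign, sgn_sum, ← Finset.prod_mul_distrib]
  refine Finset.prod_congr rfl fun x _ => Finset.prod_congr rfl fun z _ => ?_
  split_ifs
  · rw [← sgn_one (K := K), pair_add_left, pair_add_right, pair_add_right, pair_e₁_self]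
    (
      (try simp only [one_mul, mul_one, neg_mul, mul_neg, ← sgn_add, neg_sgn, neg_neg,
        zero_add, add_zero, zero_sub]) <;>
      refine sgn_eq_of_even ?_ <;> rw [Int.even_iff] <;>
      (try simp only [biDeg, pair_add_left, pair_add_right, pair_sub_left, pair_sub_right,
        pair_smul_left, pair_smul_right, Nat.cast_add, Nat.cast_one, Nat.cast_zero,
        Nat.cast_ofNat]) <;>
      (try simp only [pair_comm]) <;> ring_nf <;> omega)
  · simp

theorem sum_mul_comp_swap {p : ℕ} (x : Fin p → ℤ) {i j : Fin p} (hij : (i : ℕ) + 1 = j) :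
    ∑ s : Fin p, ((p : ℤ) - ((s : ℤ) + 1)) * x (Equiv.swap i j s) =
      ∑ s : Fin p, ((p : ℤ) - ((s : ℤ) + 1)) * x s - x i + x j := by
  have hne : i ≠ j := fun h => by subst h; omega
  rw [← Equiv.sum_comp (Equiv.swap i j)]
  simp only [Equiv.swap_apply_self]
  have : ∀ s : Fin p, ((p : ℤ) - (((Equiv.swap i j s : Fin p) : ℤ) + 1)) * x s =
      ((p : ℤ) - ((s : ℤ) + 1)) * x s - (if s = i then x s else 0) +
        (if s = j then x s else 0) := by
    intro s
    have hij' : (j : ℤ) = i + 1 := by exact_mod_cast hij.symm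
    by_cases hi : s = i
    · subst hi
      rw [Equiv.swap_apply_left, if_pos rfl, if_neg hne, hij']; ring
    · by_cases hj : s = j
      · subst hj
        rw [Equiv.swap_apply_right, if_pos rfl, if_neg hi, hij']; ring
      · rw [Equiv.swap_apply_of_ne_of_ne hi hj, if_neg hi, if_neg hj]; ring
  rw [Finset.sum_congr rfl fun s _ => this s, Finset.sum_add_distrib, Finset.sum_sub_distrib]
  simp

variable [DirectSum.Decomposition 𝒱]

theorem toDesuspension_apply {p : ℕ} (A : Cochain K V p) {d : Fin p → Deg n} {v : Fin p → V}
    (hv : ∀ i, v i ∈ desuspend 𝒱 e₁ (d i)) :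
    toDesuspension 𝒱 A v = (sgn K ((p * (p - 1) / 2 : ℕ) : ℤ) *
      sgn K (∑ s : Fin p, ((p : ℤ) - ((s : ℤ) + 1)) * pair e₁ (d s))) • A v := by
  rw [toDesuspension, homExt_apply _ _ hv, smul_apply]

theorem ofDesuspension_apply {p : ℕ} (Q : Cochain K V p) {d : Fin p → Deg n} {v : Fin p → V}
    (hv : ∀ i, v i ∈ 𝒱 (d i)) :
    ofDesuspension 𝒱 Q v =
      sgn K (∑ s : Fin p, ((p : ℤ) - ((s : ℤ) + 1)) * pair e₁ (d s)) • Q v := by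
  rw [ofDesuspension, homExt_apply _ _ hv, smul_apply]

/-- A swap changes the suspension exponent by the difference of the two values `⟨e₁, d⟩`. This and
the minus sign of antisymmetry are what the shift of degrees by `e₁` compensates. -/
theorem isGradedSymm_toDesuspension {p : ℕ} {A : Cochain K V p} (hA : IsAlphaSkew 𝒱 0 A) :
    IsGradedSymm (desuspend 𝒱 e₁) (toDesuspension 𝒱 A) := by
  intro d v hv i j hij
  rw [toDesuspension_apply A hv, toDesuspension_apply A (d := d ∘ Equiv.swap i j)
    (v := v ∘ Equiv.swap i j) (fun k => hv (Equiv.swap i j k)), hA _ v hv i j hij]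
  simp only [Function.comp_apply, add_zero]
  rw [sum_mul_comp_swap (fun s => pair e₁ (d s)) hij, pair_add_left, pair_add_right,
    pair_add_right, pair_e₁_self]
  match_scalars <;> (
    (try simp only [one_mul, mul_one, neg_mul, mul_neg, ← sgn_add, neg_sgn, neg_neg,
      zero_add, add_zero, zero_sub]) <;>
    refine sgn_eq_of_even ?_ <;> rw [Int.even_iff] <;>
    (try simp only [biDeg, pair_add_left, pair_add_right, pair_sub_left, pair_sub_right,
      pair_smul_left, pair_smul_right, Nat.cast_add, Nat.cast_one, Nat.cast_zero,
      Nat.cast_ofNat]) <;>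
    (try simp only [pair_comm]) <;> ring_nf <;> omega)

theorem hasWeight_toDesuspension {b : ℕ} {w : Deg n} {B : Cochain K V (b + 1)}
    (hB : HasWeight 𝒱 w B) :
    HasWeight (desuspend 𝒱 e₁) (w + (b : ℤ) • e₁) (toDesuspension 𝒱 B) := by
  intro d v hv
  rw [toDesuspension_apply B hv]
  refine Submodule.smul_mem _ _ ?_
  have := hB _ v hv
  rw [desuspend]
  convert this using 2
  rw [Finset.sum_add_distrib, Finset.sum_const, Finset.card_univ, Fintype.card_fin]
  module

/-- All suspension signs together turn the Koszul sign on `↓V` into signature times Koszul sign on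
`V`. The one leftover factor records the weight of `B` passing the `a` suspensions in `A` that
follow its first slot. -/
theorem ofDesuspension_corestriction_stemPhi_comp {a b m : ℕ} (hm : a + b + 1 = m)
    {wA wB : Deg n} {A : Cochain K V (a + 1)} {B : Cochain K V (b + 1)}
    (hA : IsAlphaSkew 𝒱 0 A) (hB : HasWeight 𝒱 wB B) {d : Fin m → Deg n} {v : Fin m → V}
    (hv : ∀ i, v i ∈ 𝒱 (d i)) :
    ofDesuspension 𝒱 (corestriction m ((stemPhi 𝒱 wA A).comp (stemPhi 𝒱 wB B))) v =
      sgn K (a * pair e₁ wB) • unshuffleSum d A B v := by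
  obtain ⟨δ, rfl⟩ : ∃ δ : Fin m → Deg n, d = fun i => δ i + e₁ :=
    ⟨fun i => d i - e₁, by funext i; rw [sub_add_cancel]⟩
  have hv' : ∀ i, v i ∈ desuspend 𝒱 e₁ (δ i) := hv
  rw [ofDesuspension_apply _ hv, stemPhi, stemPhi, corestriction_coderivation_comp hm
    (isGradedSymm_toDesuspension hA) (hasWeight_toDesuspension hB) hv', unshuffleSum_apply,
    Finset.smul_sum, Finset.smul_sum]
  refine Finset.sum_congr rfl fun σ hσ => ?_
  have hX := hasWeight_toDesuspension hB (fun x => δ (σ (Sum.inl x)))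
    (fun x => v (σ (Sum.inl x))) (fun x => hv' _)
  rw [toDesuspension_apply A (d := Fin.cons (wB + (b : ℤ) • e₁ + ∑ x, δ (σ (Sum.inl x)))
    fun z => δ (σ (Sum.inr z))) (Fin.cases hX fun z => hv' _),
    toDesuspension_apply B (fun x => hv' (σ (Sum.inl x))), shuffleSign_mul_koszulSign_add_e₁]
  have hcons (c : K) (x : V) (u : Fin a → V) :
      A (Fin.cons (c • x) u) = c • A (Fin.cons x u) := A.cons_smul u c x
  rw [hcons, Fin.sum_univ_succ]
  simp only [smul_smul, Fin.cons_zero, Fin.cons_succ, Finset.sum_add_distrib, pair_add_right,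
    pair_e₁_self, mul_add, mul_one, sum_sub_succ_eq, pair_sum_right, pair_smul_right]
  congr 1
  have key := sum_sub_succ_mul_unshuffle hσ (fun k => pair e₁ (δ k))
  -- The left side arises because `↓^{⊗m}` sees the degrees `δ + e₁`, whose `e₁` parts contribute `∑
  -- (m - s)`; the triangular numbers on the right are the normalisations of `φ(A)` and `φ(B)`. The
  -- cross term `a * b` cancels against the part `b e₁` of the weight of `φ(B)`.
  have hT : ((m * (m - 1) / 2 : ℕ) : ℤ) = (((a + 1) * (a + 1 - 1) / 2 : ℕ) : ℤ) +
      (((b + 1) * (b + 1 - 1) / 2 : ℕ) : ℤ) + a * b := by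
    have h1 := two_mul_triangle m
    have h2 := two_mul_triangle (a + 1)
    have h3 := two_mul_triangle (b + 1)
    subst hm
    push_cast at h1 h2 h3 ⊢
    linarith
  have c0 : ((a + 1 : ℕ) : ℤ) - (((0 : Fin (a + 1)) : ℕ) + 1) = a := by simp
  have c1 (x : Fin a) : ((a + 1 : ℕ) : ℤ) - ((x.succ : ℕ) + 1) = a - ((x : ℕ) + 1) := by
    simp only [Fin.val_succ]; push_cast; ring
  simp only [c0, c1]
  generalize ∑ x, pair e₁ (δ (σ (Sum.inl x))) = Y at key ⊢
  generalize ∑ x : Fin m, ((m : ℤ) - ((x : ℕ) + 1)) * pair e₁ (δ x) = P at key ⊢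
  generalize ∑ x, ∑ z, ite (σ (Sum.inr z) < σ (Sum.inl x)) (pair e₁ (δ (σ (Sum.inl x)))) 0 = U
    at key ⊢
  generalize ∑ x, ∑ z, ite (σ (Sum.inr z) < σ (Sum.inl x)) (pair e₁ (δ (σ (Sum.inr z)))) 0 = W
    at key ⊢
  generalize ∑ x : Fin (b + 1), (((b + 1 : ℕ) : ℤ) - ((x : ℕ) + 1)) * pair e₁ (δ (σ (Sum.inl x))) = X
    at key ⊢
  generalize ∑ z : Fin a, ((a : ℤ) - ((z : ℕ) + 1)) * pair e₁ (δ (σ (Sum.inr z))) = Z at key ⊢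
  rw [hT, eq_sub_of_add_eq key]
  generalize (((a + 1) * (a + 1 - 1) / 2 : ℕ) : ℤ) = T₁
  generalize (((b + 1) * (b + 1 - 1) / 2 : ℕ) : ℤ) = T₂
  generalize koszulSign K δ _ _ = k
  have hs : sgn K (X + Z + a * Y + W - U + (T₁ + T₂ + a * b)) * (sgn K T₁ *
      sgn K (a * pair e₁ wB + a * b + a * Y + Z) * (sgn K T₂ * sgn K X)) =
      sgn K (a * pair e₁ wB) * sgn K (U + W) := by
    simp only [← sgn_add]
    refine sgn_eq_of_even ?_
    rw [Int.even_iff]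
    ring_nf
    omega
  linear_combination k * hs

/-- The prefactor of the stem bracket is chosen so that, with the leftover sign `(-1)^{a⟨e₁, B⟩}`,
the coefficient of the sum with `B` inserted into `A` is `(-1)^{1 + ab}`; the one with `A` inserted
into `B` then has coefficient `(-1)^{⟨A, B⟩}`. -/
theorem stemBracket_eq_nrBracket {a b : ℕ} {wA wB : Deg n} {A : Cochain K V (a + 1)}
    {B : Cochain K V (b + 1)} (hA : HasWeight 𝒱 wA A) (hB : HasWeight 𝒱 wB B)
    (hA' : IsAlphaSkew 𝒱 0 A) (hB' : IsAlphaSkew 𝒱 0 B) :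
    stemBracket 𝒱 wA wB A B = nrBracket 𝒱 (a + b + 1) wA wB A B := by
  refine cochain_ext (𝒱 := 𝒱) fun d v hv => ?_
  have h1 := ofDesuspension_corestriction_stemPhi_comp (wA := wA) (m := a + b + 1) rfl hA' hB hv
  have h2 := ofDesuspension_corestriction_stemPhi_comp (wA := wB) (by rw [Nat.add_comm b a])
    hB' hA hv
  have h3 : ∀ (X Y : TensorAlgebra K V →ₗ[K] TensorAlgebra K V) (c : K),
      corestriction (a + b + 1) (X - c • Y) v =
        corestriction (a + b + 1) X v - c • corestriction (a + b + 1) Y v := fun X Y c => by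
    simp [corestriction]
  rw [ofDesuspension_apply _ hv] at h1 h2
  rw [stemBracket, smul_apply, ofDesuspension_apply _ hv, h3, smul_sub, smul_comm, h1, h2,
    nrBracket, sub_apply, smul_apply, nrInsert_apply _ _ _ _ hv, nrInsert_apply _ _ _ _ hv]
  simp only [pair_add_left, pair_add_right, pair_smul_left, pair_smul_right, pair_e₁_self]
  match_scalars <;> (
    (try simp only [one_mul, mul_one, neg_mul, mul_neg, ← sgn_add, neg_sgn, neg_neg,
      zero_add, add_zero, zero_sub]) <;>
    refine sgn_eq_of_even ?_ <;> rw [Int.even_iff] <;>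
    (try simp only [biDeg, pair_add_left, pair_add_right, pair_sub_left, pair_sub_right,
      pair_smul_left, pair_smul_right, Nat.cast_add, Nat.cast_one, Nat.cast_zero,
      Nat.cast_ofNat]) <;>
    (try simp only [pair_comm]) <;> ring_nf <;> omega)

theorem gmBracket_eq_stemPullback {α : Deg n} {a b : ℕ} (h : a + 1 + (b + 1) = a + b + 1 + 1)
    {wA wB : Deg n} {A : Cochain K V (a + 1)} {B : Cochain K V (b + 1)}
    (hA : HasWeight 𝒱 wA A) (hB : HasWeight 𝒱 wB B)
    (hA' : IsAlphaSkew 𝒱 α A) (hB' : IsAlphaSkew 𝒱 α B) :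
    gmBracket 𝒱 α (a + b + 1) (a + 1) (b + 1) h wA wB A B = stemPullback 𝒱 α wA wB A B := by
  rw [gmBracket_eq_nrPullback h hA hB hA' hB', nrPullback, stemPullback,
    stemBracket_eq_nrBracket (hA.desuspend α) (hB.desuspend α) hA'.desuspend hB'.desuspend]

end Stem

end GradedBracket

/-! ### Closure of first order operators under the bracket, and the main theorem -/

theorem GradedBracket.isDiff₁_gmBracket {K R : Type*} [Field K] [Ring R] [Algebra K R] {n : ℕ}
    {𝒜 : GradedBracket.Deg n → Submodule K R} [GradedAlgebra 𝒜]
    (hcomm : GradedBracket.IsGradedComm 𝒜) {α : GradedBracket.Deg n} {m p q : ℕ}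
    (h : p + q = m + 1) {wA wB : GradedBracket.Deg n} {A : GradedBracket.Cochain K R p}
    {B : GradedBracket.Cochain K R q} (hA : GradedBracket.IsDiff₁ 𝒜 α p wA A)
    (hB : GradedBracket.IsDiff₁ 𝒜 α q wB B) :
    GradedBracket.IsDiff₁ 𝒜 α m (wA + wB) (GradedBracket.gmBracket 𝒜 α m p q h wA wB A B) where
  weight := by
    rw [gmBracket_eq_square]
    refine .sub (square_hasWeight _ hA.weight hB.weight) (.smul _ ?_)
    rw [add_comm]
    exact square_hasWeight _ hB.weight hA.weight
  skew := by
    rw [gmBracket_eq_square]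
    exact .sub (square_isAlphaSkew _ hA.weight hB.weight hA.skew hB.skew)
      (.smul _ (square_isAlphaSkew _ hB.weight hA.weight hB.skew hA.skew))
  firstOrder := gmBracket_isFirstOrder hcomm h hA hB

theorem mainTheorem11 {K R : Type*} [Field K] [CharZero K] [Ring R] [Algebra K R]
    {n : ℕ} [NeZero n] (𝒜 : GradedBracket.Deg n → Submodule K R) [GradedAlgebra 𝒜]
    (hcomm : GradedBracket.IsGradedComm 𝒜) (α : GradedBracket.Deg n) :
    (∀ (m p q : ℕ) (h : p + q = m + 1) (wA wB : GradedBracket.Deg n)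
        (A : GradedBracket.Cochain K R p) (B : GradedBracket.Cochain K R q),
        GradedBracket.IsDiff₁ 𝒜 α p wA A → GradedBracket.IsDiff₁ 𝒜 α q wB B →
        GradedBracket.IsDiff₁ 𝒜 α m (wA + wB) (GradedBracket.gmBracket 𝒜 α m p q h wA wB A B) ∧
        GradedBracket.gmBracket 𝒜 α m p q h wA wB A B =
          GradedBracket.square 𝒜 α m p q h wA wB A B -
            GradedBracket.sgn K
                (GradedBracket.pair (GradedBracket.biDeg α wA p) (GradedBracket.biDeg α wB q) +
                  ((p : ℤ) - 1) * ((q : ℤ) - 1)) •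
              GradedBracket.square 𝒜 α m q p ((Nat.add_comm q p).trans h) wB wA B A ∧
        (∀ (d : Fin m → GradedBracket.Deg n) (v : Fin m → R), (∀ i, v i ∈ 𝒜 (d i)) →
          GradedBracket.square 𝒜 α m p q h wA wB A B v =
            GradedBracket.sgn K (1 + ((p : ℤ) - 1) * ((q : ℤ) - 1)) •
              GradedBracket.unshuffleSum (fun i => d i - α) A B v) ∧
        GradedBracket.gmBracket 𝒜 α m p q h wA wB A B =
          GradedBracket.nrPullback 𝒜 α m wA wB A B) ∧
    (∀ (a b : ℕ) (h : a + 1 + (b + 1) = a + b + 1 + 1) (wA wB : GradedBracket.Deg n)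
        (A : GradedBracket.Cochain K R (a + 1)) (B : GradedBracket.Cochain K R (b + 1)),
        GradedBracket.IsDiff₁ 𝒜 α (a + 1) wA A → GradedBracket.IsDiff₁ 𝒜 α (b + 1) wB B →
        GradedBracket.gmBracket 𝒜 α (a + b + 1) (a + 1) (b + 1) h wA wB A B =
          GradedBracket.stemPullback 𝒜 α wA wB A B) := by

  exact ⟨fun m p q h wA wB A B hA hB =>
      ⟨GradedBracket.isDiff₁_gmBracket hcomm h hA hB, GradedBracket.gmBracket_eq_square h wA wB A B,
        fun d v hv => GradedBracket.square_apply h hA.skew hB.weight d v hv,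
        GradedBracket.gmBracket_eq_nrPullback h hA.weight hB.weight hA.skew hB.skew⟩,
    fun a b h wA wB A B hA hB =>
      GradedBracket.gmBracket_eq_stemPullback h hA.weight hB.weight hA.skew hB.skew⟩
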